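/- For $s\in(0,3)$ let $f_s(x,t)=(x^4+t^2)^{-s/4}$, $(x,t)\in\mathbb{R}^2\setminus\{0\}$. Then $f_s$ is locally integrable, $\phi f_s$ is integrable for every Schwartz function $\phi\in\mathcal{S}(\mathbb{R}^2)$, and $\phi\mapsto\int_{\mathbb{R}^2}\phi f_s$ defines a tempered distribution $f_s\in\mathcal{S}'(\mathbb{R}^2)$. If $s\in(1,3)$, then the Fourier transform $\widehat{f_s}$ of this distribution, defined by $\langle\widehat{f_s},\phi\rangle=\langle f_s,\widehat{\phi}\rangle$ with $\widehat{\phi}(\xi)=\int_{\mathbb{R}^2} e^{-2\pi i\langle y,\xi\rangle}\phi(y)\,dy$, is given by a locally integrable real-valued function, again denoted by $\widehat{f_s}$: for every $\phi\in\mathcal{S}(\mathbb{R}^2)$, $\phi\widehat{f_s}$ is integrable and $\langle\widehat{f_s},\phi\rangle=\int_{\mathbb{R}^2}\phi\,\widehat{f_s}$. There is a constant $C_s>0$, depending only on $s$, such that for all $(\xi_1,\xi_2)\in\mathbb{R}^2$ with $\xi_2\neq0$ (hence for almost every point of $\mathbb{R}^2$), $$0<\widehat{f_s}(\xi_1,\xi_2)\le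 C_s f_{3-s}(\xi_1,\xi_2),$$ and $$\widehat{f_s}(\xi_1,\xi_2)=\frac{2\pi^{s/4}|\xi_2|^{\frac{s-2}{4}}}{\Gamma(s/4)}\int_{\mathbb{R}}e^{-2\pi i x\xi_1}|x|^{1-\frac s2}K_{\frac{s-2}{4}}\left(2\pi|\xi_2|x^2\right)dx,$$ where the integral converges absolutely. Here $K_\nu$ is the modified Bessel function of the second kind: for $z>0$, $K_\nu(z)=\frac{\pi}{2\sin(\nu\pi)}\left(I_{-\nu}(z)-I_\nu(z)\right)$ if $\nu\in\mathbb{R}\setminus\mathbb{Z}$, with $I_\nu(z)=\sum_{n=0}^\infty\frac{(z/2)^{\nu+2n}}{n!\,\Gamma(n+\nu+1)}$, and $K_n(z)=\lim_{\nu\to n}K_\nu(z)$ if $n\in\mathbb{Z}$. -/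

import Mathlib

open scoped SchwartzMap FourierTransform

/-- The plane `ℝ²` with its Euclidean structure; the point `(x, t)` has `p 0 = x` and `p 1 = t`. -/
abbrev Plane : Type := EuclideanSpace ℝ (Fin 2)

/-- The Korányi kernel `f_s(x, t) = 1 / (x⁴ + t²)^(s/4)` on `ℝ²`. -/
noncomputable def koranyiKernel (s : ℝ) (p : Plane) : ℝ :=
  1 / (p 0 ^ 4 + p 1 ^ 2) ^ (s / 4)

/-- The modified Bessel function of the first kind, of real order `ν`, at a real `z > 0`:
`I_ν(z) = ∑ₙ (z/2)^(ν+2n) / (n! Γ(n+ν+1))`.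
When `ν` is a negative integer, the terms with `n < -ν` are zero (`Real.Gamma` is zero at its
poles and so is division by zero), so that the sum starts at `n = -ν`, as is conventional. -/
noncomputable def modBesselI (ν z : ℝ) : ℝ :=
  ∑' n : ℕ, (z / 2) ^ (ν + 2 * (n : ℝ)) / ((n.factorial : ℝ) * Real.Gamma ((n : ℝ) + ν + 1))

/-- The quotient `π / (2 sin(νπ)) · (I_{-ν}(z) - I_ν(z))`, meaningful when `ν` is not an integer. -/
noncomputable def modBesselKQuot (ν z : ℝ) : ℝ :=
  Real.pi / (2 * Real.sin (ν * Real.pi)) * (modBesselI (-ν) z - modBesselI ν z)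

open Classical in
/-- The modified Bessel function of the second kind, of real order `ν`, at a real `z > 0`:
`π / (2 sin(νπ)) · (I_{-ν}(z) - I_ν(z))` for non-integer `ν`, and the limit of `K_μ(z)` as
`μ → ν`, `μ ≠ ν`, when `ν` is an integer. -/
noncomputable def modBesselK (ν z : ℝ) : ℝ :=
  if ∃ n : ℤ, ν = (n : ℝ) then
    Filter.limUnder (nhdsWithin ν {ν}ᶜ) (fun μ : ℝ => modBesselKQuot μ z)
  else modBesselKQuot ν z

/-- The tempered distribution `T` on `ℝ²` is (represented by) the locally integrable real-valued
function `f`: for every Schwartz function `φ`, the product `φ f` is integrable, and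
`⟨T, φ⟩ = ∫ φ f`. -/
def IsGivenBy (T : 𝓢'(Plane, ℂ)) (f : Plane → ℝ) : Prop :=
  MeasureTheory.LocallyIntegrable f MeasureTheory.volume ∧
    ∀ φ : 𝓢(Plane, ℂ),
      MeasureTheory.Integrable (fun p : Plane => φ p * (f p : ℂ)) MeasureTheory.volume ∧
        T φ = ∫ p : Plane, φ p * (f p : ℂ)

/-- The integrand `x ↦ e^{-2πi x ξ₁} |x|^{1-s/2} K_{(s-2)/4}(2π |ξ₂| x²)`, where
`ξ₁ = ξ 0` and `ξ₂ = ξ 1`. -/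
noncomputable def besselIntegrand (s : ℝ) (ξ : Plane) (x : ℝ) : ℂ :=
  Complex.exp (-2 * (Real.pi : ℂ) * Complex.I * (x : ℂ) * ((ξ 0 : ℝ) : ℂ)) *
    ((|x| ^ (1 - s / 2) * modBesselK ((s - 2) / 4) (2 * Real.pi * |ξ 1| * x ^ 2) : ℝ) : ℂ)

open MeasureTheory Set Filter Topology

/-! The Gamma integral writes Γ(s/4) f_s as the superposition of exp(-l(x⁴+t²)) against l^(s/4-1)
dl. Each of these functions is integrable, and its transform is `quarticFourier` in ξ₁ times a
Gaussian in ξ₂. The multiplication formula and Fubini give `integral_fourier_mul_koranyiKernel`, so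
`quarticSuperposition` represents Γ(s/4) times the transform. The majorant of this superposition is
a multiple of |ξ₂|^(-(3-s)/2), which is locally integrable because s > 1.

This form does not show positivity, as the transform of exp(-l x⁴) is an oscillatory integral. Doing
the l-integral before the x-integral leaves ∫ l^(s/4-3/2) exp(-π²ξ₂²/l - l x⁴) dl, a Bessel function
of order ν = (s-2)/4 at 2π|ξ₂|x²; this is the stated formula
(`quarticSuperposition_eq_besselIntegrand`). By `integral_rpow_mul_exp_neg_sqrt`, the Bessel
function is in turn a positive superposition of exponentials that are Gaussian in x. Transforming
them one by one gives `koranyiFourier`, a positive constant times |ξ₂|^(-(3-s)/2) M(ξ₁²/|ξ₂|) with M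
> 0 (`quarticSuperposition_eq_koranyiFourier`). The upper bound follows from M(r) ≤ M(0) and M(r) ≤
C r^(-(3-s)/2), used for ξ₁² ≤ |ξ₂| and ξ₁² > |ξ₂| respectively.

K_ν is defined through I_{±ν}, so its integral form has to be proved. `cliffordK_eq` does this for 0
< |ν| < 1 by comparing Wronskians at 0, and `modBesselK_eq` adds ν = 0, that is s = 2, by continuity
in the order. -/

/-! ### The entire series `∑ wⁿ / (n! Γ(n + ν + 1))` -/

/-- The Bessel–Clifford series `∑ wⁿ / (n! Γ(n + ν + 1))`. -/
noncomputable def cliffordSeries (ν w : ℝ) : ℝ :=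
  ∑' n : ℕ, w ^ n / ((n.factorial : ℝ) * Real.Gamma ((n : ℝ) + ν + 1))

/-- Once n ≥ -ν, the functional equation of Γ divides 1/Γ by a number at least 1 at each step, so
the finitely many earlier values control all the others. -/
lemma exists_abs_inv_Gamma_le (ν : ℝ) :
    ∃ C : ℝ, 0 ≤ C ∧ ∀ n : ℕ, |(Real.Gamma ((n : ℝ) + ν + 1))⁻¹| ≤ C := by
  obtain ⟨N, hN⟩ := exists_nat_ge (-ν)
  refine ⟨∑ i ∈ Finset.range (N + 1), |(Real.Gamma ((i : ℝ) + ν + 1))⁻¹|,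
    Finset.sum_nonneg fun _ _ => abs_nonneg _, fun n => ?_⟩
  have small : ∀ n ≤ N, |(Real.Gamma ((n : ℝ) + ν + 1))⁻¹| ≤
      ∑ i ∈ Finset.range (N + 1), |(Real.Gamma ((i : ℝ) + ν + 1))⁻¹| := fun n hn =>
    Finset.single_le_sum (f := fun i : ℕ => |(Real.Gamma ((i : ℝ) + ν + 1))⁻¹|)
      (fun _ _ => abs_nonneg _) (Finset.mem_range.2 (by omega))
  induction n with
  | zero => exact small 0 (Nat.zero_le _)
  | succ k ih =>
    by_cases hk : k + 1 ≤ N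
    · exact small _ hk
    · refine le_trans ?_ ih
      have hkN : (N : ℝ) ≤ k := by exact_mod_cast (by omega : N ≤ k)
      have h1 : 1 ≤ (k : ℝ) + ν + 1 := by linarith
      have : Real.Gamma (((k + 1 : ℕ) : ℝ) + ν + 1) =
          ((k : ℝ) + ν + 1) * Real.Gamma ((k : ℝ) + ν + 1) := by
        rw [← Real.Gamma_add_one (by linarith)]; push_cast; ring_nf
      rw [this, mul_inv, abs_mul]
      refine mul_le_of_le_one_left (abs_nonneg _) ?_
      rw [abs_of_nonneg (by positivity)]
      exact inv_le_one_of_one_le₀ h1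

lemma summable_cliffordSeries (ν w : ℝ) :
    Summable fun n : ℕ => w ^ n / ((n.factorial : ℝ) * Real.Gamma ((n : ℝ) + ν + 1)) := by
  obtain ⟨C, -, hC⟩ := exists_abs_inv_Gamma_le ν
  refine Summable.of_norm_bounded
    ((Real.summable_pow_div_factorial |w|).mul_right C) fun n => ?_
  rw [Real.norm_eq_abs, div_mul_eq_div_div, div_eq_mul_inv _ (Real.Gamma _), abs_mul, abs_div,
    abs_pow, Nat.abs_cast]
  exact mul_le_mul_of_nonneg_left (hC n) (by positivity)

lemma cliffordSeries_term_succ (ν w : ℝ) (n : ℕ) :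
    ((n + 1 : ℕ) : ℝ) * w ^ (n + 1 - 1) /
        (((n + 1).factorial : ℝ) * Real.Gamma (((n + 1 : ℕ) : ℝ) + ν + 1)) =
      w ^ n / ((n.factorial : ℝ) * Real.Gamma ((n : ℝ) + (ν + 1) + 1)) := by
  have : ((n + 1 : ℕ) : ℝ) + ν + 1 = (n : ℝ) + (ν + 1) + 1 := by push_cast; ring
  rw [this, Nat.factorial_succ, Nat.add_sub_cancel]
  have h : ((n + 1 : ℕ) : ℝ) ≠ 0 := by positivity
  push_cast at h ⊢
  rw [mul_assoc, mul_div_mul_left _ _ h]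

lemma hasSum_deriv_cliffordSeries (ν w : ℝ) :
    HasSum (fun n : ℕ => (n : ℝ) * w ^ (n - 1) /
      ((n.factorial : ℝ) * Real.Gamma ((n : ℝ) + ν + 1))) (cliffordSeries (ν + 1) w) := by
  rw [← hasSum_nat_add_iff' 1]
  simp only [Finset.range_one, Finset.sum_singleton, Nat.cast_zero, zero_mul, zero_div, sub_zero]
  simp_rw [cliffordSeries_term_succ]
  exact (summable_cliffordSeries (ν + 1) w).hasSum

lemma hasDerivAt_cliffordSeries (ν w : ℝ) :
    HasDerivAt (cliffordSeries ν) (cliffordSeries (ν + 1) w) w := by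
  rw [← (hasSum_deriv_cliffordSeries ν w).tsum_eq]
  obtain ⟨C, hC0, hC⟩ := exists_abs_inv_Gamma_le ν
  set R : ℝ := |w| + 1
  have hR : 0 ≤ R := by positivity
  have hu : Summable fun n : ℕ => (n : ℝ) * R ^ (n - 1) / (n.factorial : ℝ) * C := by
    refine Summable.mul_right C ?_
    rw [← summable_nat_add_iff 1]
    refine (Real.summable_pow_div_factorial R).congr fun n => ?_
    rw [Nat.factorial_succ, Nat.add_sub_cancel]
    have h : ((n + 1 : ℕ) : ℝ) ≠ 0 := by positivity
    push_cast at h ⊢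
    rw [mul_div_mul_left _ _ h]
  refine hasDerivAt_tsum_of_isPreconnected (t := Metric.ball (0 : ℝ) R) (y₀ := 0)
    (g := fun (n : ℕ) (y : ℝ) => y ^ n / ((n.factorial : ℝ) * Real.Gamma ((n : ℝ) + ν + 1)))
    (g' := fun (n : ℕ) (y : ℝ) =>
      (n : ℝ) * y ^ (n - 1) / ((n.factorial : ℝ) * Real.Gamma ((n : ℝ) + ν + 1)))
    hu Metric.isOpen_ball (convex_ball _ _).isPreconnected (fun n y _ => ?_) (fun n y hy => ?_) ?_
    (summable_cliffordSeries ν 0) ?_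
  · exact (hasDerivAt_pow n y).div_const _
  · rw [Real.norm_eq_abs, div_mul_eq_div_div, div_eq_mul_inv _ (Real.Gamma _), abs_mul, abs_div,
      abs_mul, abs_pow, Nat.abs_cast, Nat.abs_cast]
    have hy' : |y| ≤ R := by simpa using (mem_ball_zero_iff.1 hy).le
    gcongr
    exact hC n
  · simp only [Metric.mem_ball, dist_self]; positivity
  · simp only [mem_ball_zero_iff, Real.norm_eq_abs, R]; linarith

lemma continuous_cliffordSeries (ν : ℝ) : Continuous (cliffordSeries ν) :=
  continuous_iff_continuousAt.2 fun w => (hasDerivAt_cliffordSeries ν w).continuousAt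

lemma cliffordSeries_zero (ν : ℝ) : cliffordSeries ν 0 = (Real.Gamma (ν + 1))⁻¹ := by
  rw [cliffordSeries, tsum_eq_single 0]
  · simp
  · intro n hn; simp [hn]

/-- Termwise this is 1/Γ(n+ν) = (n+ν)/Γ(n+ν+1); the part with factor n is w times the differentiated
series. -/
lemma cliffordSeries_sub_one (ν w : ℝ) :
    cliffordSeries (ν - 1) w = ν * cliffordSeries ν w + w * cliffordSeries (ν + 1) w := by
  have h := (((summable_cliffordSeries ν w).hasSum.mul_left ν).add
    ((hasSum_deriv_cliffordSeries ν w).mul_left w)).tsum_eq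
  rw [← cliffordSeries] at h
  rw [← h, cliffordSeries]
  refine tsum_congr fun n => ?_
  have key : (Real.Gamma ((n : ℝ) + (ν - 1) + 1))⁻¹ =
      ((n : ℝ) + ν) * (Real.Gamma ((n : ℝ) + ν + 1))⁻¹ := by
    have e : (n : ℝ) + (ν - 1) + 1 = n + ν := by ring
    rw [e]
    -- At this pole `Real.Gamma` is 0 and so is its inverse, which agrees with the entire function
    -- 1/Γ.
    by_cases h0 : (n : ℝ) + ν = 0
    · rw [h0, Real.Gamma_zero]; simp
    · rw [Real.Gamma_add_one h0, mul_inv, mul_inv_cancel_left₀ h0]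
  have hw : w * ((n : ℝ) * w ^ (n - 1)) = n * w ^ n := by
    cases n with
    | zero => simp
    | succ k => rw [Nat.add_sub_cancel, pow_succ]; ring
  rw [← mul_div_assoc, ← mul_div_assoc, hw, div_mul_eq_div_div, div_mul_eq_div_div,
    div_mul_eq_div_div, div_eq_mul_inv _ (Real.Gamma _), div_eq_mul_inv _ (Real.Gamma _),
    div_eq_mul_inv _ (Real.Gamma _), key]
  ring

lemma hasDerivAt_rpow_mul_cliffordSeries (ν : ℝ) {w : ℝ} (hw : 0 < w) :
    HasDerivAt (fun w => w ^ ν * cliffordSeries ν w) (w ^ (ν - 1) * cliffordSeries (ν - 1) w) w := by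
  refine ((Real.hasDerivAt_rpow_const (p := ν) (Or.inl hw.ne')).mul
    (hasDerivAt_cliffordSeries ν w)).congr_deriv ?_
  rw [cliffordSeries_sub_one, Real.rpow_sub_one hw.ne']
  field_simp

/-! ### Integrals `∫ u^a exp(-b u - w / u)` -/

/-- The factor exp(-w/u) is at most n! (u/w)ⁿ for every n, which removes any power singularity at 0.
-/
lemma integrableOn_rpow_mul_exp_neg_sub_div (a : ℝ) {b w : ℝ} (hb : 0 < b) (hw : 0 < w) :
    IntegrableOn (fun u : ℝ => u ^ a * Real.exp (-b * u - w / u)) (Ioi 0) := by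
  obtain ⟨n, hn⟩ := exists_nat_gt (-1 - a)
  have hint := (integrableOn_rpow_mul_exp_neg_mul_rpow (p := 1) (s := a + n) (b := b)
    (by linarith) one_pos hb).const_mul ((n.factorial : ℝ) / w ^ n)
  refine Integrable.mono' hint
    ((by fun_prop : Measurable fun u : ℝ => u ^ a * Real.exp (-b * u - w / u)).aestronglyMeasurable)
    ((ae_restrict_iff' measurableSet_Ioi).2 (ae_of_all _ fun u hu => ?_))
  have hu : 0 < u := hu
  rw [Real.norm_eq_abs, abs_of_nonneg (by positivity), Real.rpow_one, Real.rpow_add hu,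
    Real.rpow_natCast, sub_eq_add_neg, Real.exp_add]
  have h := Real.pow_div_factorial_le_exp (w / u) (by positivity) n
  have h2 : Real.exp (-(w / u)) ≤ (n.factorial : ℝ) / w ^ n * u ^ n := by
    rw [Real.exp_neg, inv_le_comm₀ (Real.exp_pos _) (by positivity)]
    refine le_trans (le_of_eq ?_) h
    rw [div_pow]; field_simp
  calc u ^ a * (Real.exp (-b * u) * Real.exp (-(w / u)))
      ≤ u ^ a * (Real.exp (-b * u) * ((n.factorial : ℝ) / w ^ n * u ^ n)) := by gcongr
    _ = _ := by ring

/-- The integral `∫₀^∞ u^(-ν-1) exp(-u - w/u) du`, which is `2 w^(-ν/2) K_ν(2√w)`. -/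
noncomputable def cliffordK (ν w : ℝ) : ℝ :=
  ∫ u in Ioi (0 : ℝ), u ^ (-ν - 1) * Real.exp (-1 * u - w / u)

lemma integrableOn_cliffordK (ν : ℝ) {w : ℝ} (hw : 0 < w) :
    IntegrableOn (fun u : ℝ => u ^ (-ν - 1) * Real.exp (-1 * u - w / u)) (Ioi 0) :=
  integrableOn_rpow_mul_exp_neg_sub_div _ one_pos hw

lemma integral_rpow_mul_exp_neg_sub_div (ν w : ℝ) {b : ℝ} (hb : 0 < b) :
    ∫ u in Ioi (0 : ℝ), u ^ (-ν - 1) * Real.exp (-b * u - w / u) = b ^ ν * cliffordK ν (b * w) := by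
  have h := integral_comp_mul_left_Ioi
    (fun u : ℝ => u ^ (-ν - 1) * Real.exp (-1 * u - b * w / u)) 0 hb
  rw [mul_zero, ← cliffordK] at h
  have h2 : cliffordK ν (b * w) = b * ∫ x in Ioi (0 : ℝ),
      (b * x) ^ (-ν - 1) * Real.exp (-1 * (b * x) - b * w / (b * x)) := by
    rw [h, smul_eq_mul, mul_inv_cancel_left₀ hb.ne']
  rw [h2, ← mul_assoc, ← integral_const_mul]
  refine setIntegral_congr_fun measurableSet_Ioi fun u hu => ?_
  have hu : 0 < u := hu
  rw [Real.mul_rpow hb.le hu.le, mul_div_mul_left _ _ hb.ne']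
  have : b ^ ν * b * b ^ (-ν - 1) = 1 := by
    rw [← Real.rpow_add_one hb.ne', ← Real.rpow_add hb]; simp
  calc _ = (b ^ ν * b * b ^ (-ν - 1)) * (u ^ (-ν - 1) * Real.exp (-b * u - w / u)) := by
        rw [this, one_mul]
    _ = _ := by ring_nf

/-- The symmetry K_ν = K_{-ν}, obtained from u ↦ 1/u followed by a rescaling. -/
lemma cliffordK_eq_rpow_mul (ν : ℝ) {w : ℝ} (hw : 0 < w) :
    cliffordK ν w = w ^ (-ν) * cliffordK (-ν) w := by
  have h := integral_comp_rpow_Ioi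
    (fun u : ℝ => u ^ (-(-ν) - 1) * Real.exp (-w * u - 1 / u)) (p := -1) (by norm_num)
  rw [integral_rpow_mul_exp_neg_sub_div (-ν) 1 hw, mul_one] at h
  rw [← h, cliffordK]
  refine setIntegral_congr_fun measurableSet_Ioi fun u hu => ?_
  have hu : 0 < u := hu
  simp only [smul_eq_mul, abs_neg, abs_one, one_mul]
  rw [← mul_assoc, ← Real.rpow_mul hu.le, ← Real.rpow_add hu, Real.rpow_neg_one]
  congr 1
  · congr 1; ring
  · congr 1; field_simp; ring

lemma hasDerivAt_cliffordK (ν : ℝ) {w : ℝ} (hw : 0 < w) :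
    HasDerivAt (cliffordK ν) (-cliffordK (ν + 1) w) w := by
  -- The integrand at parameter w/2 dominates those at all parameters above w/2, hence on a
  -- neighbourhood of w.
  have hbound : IntegrableOn
      (fun u : ℝ => u ^ (-(ν + 1) - 1) * Real.exp (-1 * u - w / 2 / u)) (Ioi 0) :=
    integrableOn_cliffordK (ν + 1) (half_pos hw)
  have h := hasDerivAt_integral_of_dominated_loc_of_deriv_le (μ := volume.restrict (Ioi (0 : ℝ)))
    (F := fun w u => u ^ (-ν - 1) * Real.exp (-1 * u - w / u))
    (F' := fun w u => -(u ^ (-(ν + 1) - 1) * Real.exp (-1 * u - w / u)))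
    (Ioi_mem_nhds (half_lt_self hw)) (Eventually.of_forall fun x => ?_)
    (integrableOn_cliffordK ν hw) ?_ ?_ hbound ?_
  · refine h.2.congr_deriv ?_
    rw [integral_neg, cliffordK]
  · exact (by fun_prop : Measurable
      fun u : ℝ => u ^ (-ν - 1) * Real.exp (-1 * u - x / u)).aestronglyMeasurable
  · exact (by fun_prop : Measurable
      fun u : ℝ => -(u ^ (-(ν + 1) - 1) * Real.exp (-1 * u - w / u))).aestronglyMeasurable
  · filter_upwards [ae_restrict_mem measurableSet_Ioi] with u hu x hx
    have hu : 0 < u := hu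
    have hx : w / 2 < x := hx
    rw [norm_neg, Real.norm_eq_abs, abs_of_nonneg (by positivity)]
    gcongr
  · filter_upwards [ae_restrict_mem measurableSet_Ioi] with u hu x _
    have hu : 0 < u := hu
    have h1 : HasDerivAt (fun x : ℝ => -1 * u - x / u) (-(1 / u)) x := by
      simpa using ((hasDerivAt_id x).div_const u).const_sub (-1 * u)
    refine (h1.exp.const_mul (u ^ (-ν - 1))).congr_deriv ?_
    have : -(ν + 1) - 1 = (-ν - 1) - 1 := by ring
    rw [this, Real.rpow_sub_one hu.ne' (-ν - 1)]
    ring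

/-- Reflecting the order ν + 1 isolates the singular power of w: for ν > -1 the remaining factor has
a finite limit at 0, as the Wronskian argument requires. -/
lemma hasDerivAt_cliffordK' (ν : ℝ) {w : ℝ} (hw : 0 < w) :
    HasDerivAt (cliffordK ν) (-(w ^ (-1 - ν) * cliffordK (-ν - 1) w)) w := by
  refine (hasDerivAt_cliffordK ν hw).congr_deriv ?_
  rw [cliffordK_eq_rpow_mul _ hw]
  ring_nf

lemma tendsto_cliffordK {ν : ℝ} (hν : ν < 0) :
    Tendsto (cliffordK ν) (𝓝[>] 0) (𝓝 (Real.Gamma (-ν))) := by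
  rw [Real.Gamma_eq_integral (by linarith)]
  have hb := Real.GammaIntegral_convergent (s := -ν) (by linarith)
  refine tendsto_integral_filter_of_dominated_convergence _ (Eventually.of_forall fun x =>
    (by fun_prop : Measurable
      fun u : ℝ => u ^ (-ν - 1) * Real.exp (-1 * u - x / u)).aestronglyMeasurable) ?_ hb ?_
  · filter_upwards [self_mem_nhdsWithin] with w hw
    filter_upwards [ae_restrict_mem measurableSet_Ioi] with u hu
    have hu : 0 < u := hu
    have hw : 0 < w := hw
    rw [Real.norm_eq_abs, abs_of_nonneg (by positivity), mul_comm]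
    gcongr
    have : 0 < w / u := by positivity
    linarith
  · filter_upwards [ae_restrict_mem measurableSet_Ioi] with u hu
    have : Continuous fun w : ℝ => u ^ (-ν - 1) * Real.exp (-1 * u - w / u) := by fun_prop
    have h := (this.tendsto 0).mono_left (nhdsWithin_le_nhds (s := Ioi 0))
    simpa [mul_comm] using h

/-! ### Connection formula -/

lemma eq_of_hasDerivAt_zero_of_tendsto {f : ℝ → ℝ} {c : ℝ}
    (hf : ∀ w, 0 < w → HasDerivAt f 0 w) (hc : Tendsto f (𝓝[>] 0) (𝓝 c)) {w : ℝ} (hw : 0 < w) :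
    f w = c := by
  refine tendsto_nhds_unique (tendsto_const_nhds.congr' ?_) hc
  filter_upwards [self_mem_nhdsWithin] with x hx
  exact isOpen_Ioi.is_const_of_deriv_eq_zero (convex_Ioi (0 : ℝ)).isPreconnected
    (fun y hy => (hf y hy).differentiableAt.differentiableWithinAt) (fun y hy => (hf y hy).deriv)
    hw hx

/-- The Wronskian of two solutions of `w y'' + (1 + ν) y' = y`, with `y₁ = w^(1+ν) y'`. -/
lemma wronskian_eq_of_tendsto {ν : ℝ} {y y₁ z z₁ : ℝ → ℝ}
    (hy : ∀ w, 0 < w → HasDerivAt y (w ^ (-1 - ν) * y₁ w) w)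
    (hy₁ : ∀ w, 0 < w → HasDerivAt y₁ (w ^ ν * y w) w)
    (hz : ∀ w, 0 < w → HasDerivAt z (w ^ (-1 - ν) * z₁ w) w)
    (hz₁ : ∀ w, 0 < w → HasDerivAt z₁ (w ^ ν * z w) w)
    {a a₁ b b₁ : ℝ} (ha : Tendsto y (𝓝[>] 0) (𝓝 a)) (ha₁ : Tendsto y₁ (𝓝[>] 0) (𝓝 a₁))
    (hb : Tendsto z (𝓝[>] 0) (𝓝 b)) (hb₁ : Tendsto z₁ (𝓝[>] 0) (𝓝 b₁)) {w : ℝ} (hw : 0 < w) :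
    y w * z₁ w - y₁ w * z w = a * b₁ - a₁ * b := by
  refine eq_of_hasDerivAt_zero_of_tendsto (f := fun w => y w * z₁ w - y₁ w * z w) (fun w hw => ?_)
    ((ha.mul hb₁).sub (ha₁.mul hb)) hw
  exact (((hy w hw).mul (hz₁ w hw)).sub ((hy₁ w hw).mul (hz w hw))).congr_deriv (by ring)

/-- Three solutions of one second-order equation are compared: f = `cliffordK ν`, p =
`cliffordSeries ν` and q = w^(-ν) `cliffordSeries (-ν)`. Their weighted Wronskians are constant,
hence determined at 0: W(f,p) = W(f,q) = 1 and W(p,q) = 1/(Γ(ν+1)Γ(-ν)). For -1 < ν < 0 all the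
limits involved are finite. -/
lemma cliffordK_eq_of_mem_Ioo {ν : ℝ} (h1 : -1 < ν) (h0 : ν < 0) {w : ℝ} (hw : 0 < w) :
    cliffordK ν w = Real.pi / Real.sin (ν * Real.pi) *
      (w ^ (-ν) * cliffordSeries (-ν) w - cliffordSeries ν w) := by
  have hf : ∀ w : ℝ, 0 < w →
      HasDerivAt (cliffordK ν) (w ^ (-1 - ν) * -cliffordK (-ν - 1) w) w := fun w hw =>
    (hasDerivAt_cliffordK' ν hw).congr_deriv (by ring)
  have hf₁ : ∀ w : ℝ, 0 < w →
      HasDerivAt (fun w => -cliffordK (-ν - 1) w) (w ^ ν * cliffordK ν w) w := fun w hw =>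
    (hasDerivAt_cliffordK' (-ν - 1) hw).neg.congr_deriv (by ring_nf)
  have hp : ∀ w : ℝ, 0 < w → HasDerivAt (cliffordSeries ν)
      (w ^ (-1 - ν) * (w ^ (1 + ν) * cliffordSeries (1 + ν) w)) w := fun w hw => by
    refine (hasDerivAt_cliffordSeries ν w).congr_deriv ?_
    have e : -1 - ν + (1 + ν) = 0 := by ring
    rw [← mul_assoc, ← Real.rpow_add hw, e, Real.rpow_zero, one_mul, add_comm]
  have hp₁ : ∀ w : ℝ, 0 < w → HasDerivAt (fun w => w ^ (1 + ν) * cliffordSeries (1 + ν) w)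
      (w ^ ν * cliffordSeries ν w) w := fun w hw => by
    simpa using hasDerivAt_rpow_mul_cliffordSeries (1 + ν) hw
  have hq : ∀ w : ℝ, 0 < w → HasDerivAt (fun w => w ^ (-ν) * cliffordSeries (-ν) w)
      (w ^ (-1 - ν) * cliffordSeries (-ν - 1) w) w := fun w hw =>
    (hasDerivAt_rpow_mul_cliffordSeries (-ν) hw).congr_deriv (by ring_nf)
  have hq₁ : ∀ w : ℝ, 0 < w → HasDerivAt (cliffordSeries (-ν - 1))
      (w ^ ν * (w ^ (-ν) * cliffordSeries (-ν) w)) w := fun w hw => by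
    refine (hasDerivAt_cliffordSeries (-ν - 1) w).congr_deriv ?_
    rw [← mul_assoc, ← Real.rpow_add hw]; simp
  have lp : ∀ μ : ℝ, Tendsto (cliffordSeries μ) (𝓝[>] 0) (𝓝 (Real.Gamma (μ + 1))⁻¹) := fun μ => by
    rw [← cliffordSeries_zero]
    exact ((continuous_cliffordSeries μ).tendsto 0).mono_left nhdsWithin_le_nhds
  have lz : ∀ {a : ℝ} (μ : ℝ), 0 < a →
      Tendsto (fun w => w ^ a * cliffordSeries μ w) (𝓝[>] 0) (𝓝 0) := fun {a} μ ha => by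
    have : Continuous fun w : ℝ => w ^ a * cliffordSeries μ w :=
      (Real.continuous_rpow_const ha.le).mul (continuous_cliffordSeries μ)
    have h := (this.tendsto 0).mono_left (nhdsWithin_le_nhds (s := Ioi 0))
    simpa [Real.zero_rpow ha.ne'] using h
  have lf := tendsto_cliffordK h0
  have lf₁ := (tendsto_cliffordK (ν := -ν - 1) (by linarith)).neg
  have lq₁ := lp (-ν - 1)
  rw [sub_add_cancel] at lq₁
  have g0 : Real.Gamma (-ν) ≠ 0 := (Real.Gamma_pos_of_pos (by linarith)).ne'
  have g1 : Real.Gamma (ν + 1) ≠ 0 := (Real.Gamma_pos_of_pos (by linarith)).ne'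
  have e1 := wronskian_eq_of_tendsto hf hf₁ hp hp₁ lf lf₁ (lp ν) (lz _ (by linarith)) hw
  have e2 := wronskian_eq_of_tendsto hf hf₁ hq hq₁ lf lf₁ (lz _ (by linarith)) lq₁ hw
  have e3 := wronskian_eq_of_tendsto hp hp₁ hq hq₁ (lp ν) (lz _ (by linarith))
    (lz _ (by linarith)) lq₁ hw
  have e : -(-ν - 1) = ν + 1 := by ring
  rw [e, mul_zero, neg_mul (Real.Gamma _), mul_inv_cancel₀ g1] at e1
  rw [mul_zero, mul_inv_cancel₀ g0] at e2
  have hG := Real.Gamma_mul_Gamma_one_sub (-ν)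
  have hs : Real.pi / Real.sin (ν * Real.pi) = -(Real.Gamma (-ν) * Real.Gamma (ν + 1)) := by
    have e' : 1 - -ν = ν + 1 := by ring
    rw [e'] at hG
    rw [hG, mul_neg, Real.sin_neg, mul_comm, div_neg, neg_neg]
  rw [hs]
  -- This is the identity f W(p,q) = p W(f,q) - q W(f,p), valid for any three pairs.
  have hc : cliffordK ν w * ((Real.Gamma (ν + 1))⁻¹ * (Real.Gamma (-ν))⁻¹) =
      cliffordSeries ν w - w ^ (-ν) * cliffordSeries (-ν) w := by
    linear_combination (-cliffordK ν w) * e3 + cliffordSeries ν w * e2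
      - (w ^ (-ν) * cliffordSeries (-ν) w) * e1
  have := congrArg (fun t => (Real.Gamma (-ν) * Real.Gamma (ν + 1)) * t) hc
  field_simp at this ⊢
  linarith

lemma cliffordK_eq {ν : ℝ} (h : |ν| < 1) (h0 : ν ≠ 0) {w : ℝ} (hw : 0 < w) :
    cliffordK ν w = Real.pi / Real.sin (ν * Real.pi) *
      (w ^ (-ν) * cliffordSeries (-ν) w - cliffordSeries ν w) := by
  obtain ⟨h1, h2⟩ := abs_lt.1 h
  rcases lt_or_gt_of_ne h0 with hn | hp
  · exact cliffordK_eq_of_mem_Ioo h1 hn hw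
  · rw [cliffordK_eq_rpow_mul _ hw, cliffordK_eq_of_mem_Ioo (by linarith) (by linarith) hw,
      neg_neg, neg_mul, Real.sin_neg]
    have : w ^ (-ν) * w ^ ν = 1 := by rw [← Real.rpow_add hw]; simp
    rw [div_neg]
    linear_combination (-(Real.pi / Real.sin (ν * Real.pi)) * cliffordSeries ν w) * this

/-! ### The modified Bessel function of the second kind -/

lemma modBesselI_eq (ν : ℝ) {z : ℝ} (hz : 0 < z) :
    modBesselI ν z = (z / 2) ^ ν * cliffordSeries ν (z ^ 2 / 4) := by
  rw [modBesselI, cliffordSeries, ← tsum_mul_left]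
  refine tsum_congr fun n => ?_
  have : (2 : ℝ) * (n : ℝ) = ((2 * n : ℕ) : ℝ) := by push_cast; ring
  rw [Real.rpow_add (by positivity), this, Real.rpow_natCast, pow_mul, mul_div_assoc]
  congr 3
  ring

lemma modBesselKQuot_eq {ν : ℝ} (h : |ν| < 1) (h0 : ν ≠ 0) {z : ℝ} (hz : 0 < z) :
    modBesselKQuot ν z = 1 / 2 * (z / 2) ^ ν * cliffordK ν (z ^ 2 / 4) := by
  rw [modBesselKQuot, modBesselI_eq _ hz, modBesselI_eq _ hz, cliffordK_eq h h0 (by positivity)]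
  have e : z ^ 2 / 4 = (z / 2) ^ (2 : ℝ) := by
    rw [Real.rpow_two]; ring
  have hp : (z ^ 2 / 4) ^ (-ν) = (z / 2) ^ (-ν) * (z / 2) ^ (-ν) := by
    rw [e, ← Real.rpow_mul (by positivity), ← Real.rpow_add (by positivity)]; ring_nf
  have hq : (z / 2) ^ ν * (z / 2) ^ (-ν) = 1 := by
    rw [← Real.rpow_add (by positivity)]; simp
  rw [hp, ← div_div, div_right_comm]
  linear_combination (-(1 / 2) * (Real.pi / Real.sin (ν * Real.pi)) * (z / 2) ^ (-ν) *
    cliffordSeries (-ν) (z ^ 2 / 4)) * hq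

lemma tendsto_cliffordK_order {w : ℝ} (hw : 0 < w) :
    Tendsto (fun ν => cliffordK ν w) (𝓝 0) (𝓝 (cliffordK 0 w)) := by
  -- For |ν| < 1 the power u^(-ν-1) is at most u^(-2) when u ≤ 1 and at most 1 when u ≥ 1.
  have hb := (integrableOn_rpow_mul_exp_neg_sub_div (-2) one_pos hw).add
    (integrableOn_rpow_mul_exp_neg_sub_div 0 one_pos hw)
  refine tendsto_integral_filter_of_dominated_convergence _ (Eventually.of_forall fun x =>
    (by fun_prop : Measurable
      fun u : ℝ => u ^ (-x - 1) * Real.exp (-1 * u - w / u)).aestronglyMeasurable) ?_ hb ?_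
  · filter_upwards [Ioo_mem_nhds (a := (-1 : ℝ)) (b := 1) (by norm_num) (by norm_num)] with ν hν
    filter_upwards [ae_restrict_mem measurableSet_Ioi] with u hu
    have hu : 0 < u := hu
    rw [Real.norm_eq_abs, abs_of_nonneg (by positivity), Pi.add_apply, ← add_mul]
    gcongr
    rcases le_total u 1 with h | h
    · have := Real.rpow_le_rpow_of_exponent_ge hu h (by linarith [hν.2] : (-2 : ℝ) ≤ -ν - 1)
      exact this.trans (le_add_of_nonneg_right (by positivity))
    · have := Real.rpow_le_rpow_of_exponent_le h (by linarith [hν.1] : -ν - 1 ≤ (0 : ℝ))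
      exact this.trans (le_add_of_nonneg_left (by positivity))
  · filter_upwards [ae_restrict_mem measurableSet_Ioi] with u hu
    have hu : 0 < u := hu
    have : Continuous fun ν : ℝ => u ^ (-ν - 1) * Real.exp (-1 * u - w / u) := by
      have : Continuous fun ν : ℝ => u ^ (-ν - 1) :=
        continuous_const.rpow (by fun_prop) fun _ => Or.inl hu.ne'
      fun_prop
    exact this.tendsto 0

lemma modBesselK_eq {ν : ℝ} (h : |ν| < 1) {z : ℝ} (hz : 0 < z) :
    modBesselK ν z = 1 / 2 * (z / 2) ^ ν * cliffordK ν (z ^ 2 / 4) := by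
  rw [modBesselK]
  split_ifs with hn
  · obtain ⟨n, rfl⟩ := hn
    have : n = 0 := by
      have : |n| < 1 := by exact_mod_cast h
      exact Int.abs_lt_one_iff.1 this
    subst this
    rw [Int.cast_zero]
    refine Tendsto.limUnder_eq ?_
    have hc : Tendsto (fun μ : ℝ => 1 / 2 * (z / 2) ^ μ * cliffordK μ (z ^ 2 / 4)) (𝓝 0)
        (𝓝 (1 / 2 * (z / 2) ^ (0 : ℝ) * cliffordK 0 (z ^ 2 / 4))) := by
      refine Tendsto.mul ?_ (tendsto_cliffordK_order (by positivity))
      have : Continuous fun ν : ℝ => 1 / 2 * (z / 2) ^ ν :=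
        continuous_const.mul (continuous_const.rpow continuous_id fun _ => Or.inl (by positivity))
      exact this.tendsto 0
    refine (hc.mono_left (nhdsWithin_le_nhds (s := {0}ᶜ))).congr' ?_
    filter_upwards [self_mem_nhdsWithin, nhdsWithin_le_nhds
      (Ioo_mem_nhds (a := (-1 : ℝ)) (b := 1) (by norm_num) (by norm_num))] with μ h0 h1
    exact (modBesselKQuot_eq (abs_lt.2 h1) h0 hz).symm
  · refine modBesselKQuot_eq h ?_ hz
    rintro rfl
    exact hn ⟨0, by simp⟩

/-! ### Poisson-type representation -/

/-- At ν = -1/2 the orders ν and -ν - 1 coincide, so the derivative formula closes up as y' =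
-w^(-1/2) y. Thus y exp(2√w) is constant, equal to its limit Γ(1/2) at 0. -/
lemma cliffordK_neg_half {w : ℝ} (hw : 0 < w) :
    cliffordK (-(1 / 2)) w = √Real.pi * Real.exp (-2 * √w) := by
  have hs : Tendsto (fun w : ℝ => Real.exp (2 * √w)) (𝓝[>] 0) (𝓝 1) := by
    have : Continuous fun w : ℝ => Real.exp (2 * √w) := by fun_prop
    have h := (this.tendsto 0).mono_left (nhdsWithin_le_nhds (s := Ioi 0))
    simpa using h
  have hl := (tendsto_cliffordK (ν := -(1 / 2)) (by norm_num)).mul hs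
  rw [neg_neg, Real.Gamma_one_half_eq, mul_one] at hl
  have := eq_of_hasDerivAt_zero_of_tendsto
    (f := fun w => cliffordK (-(1 / 2)) w * Real.exp (2 * √w)) (fun w hw => ?_) hl hw
  · have h2 : Real.exp (2 * √w) * Real.exp (-2 * √w) = 1 := by rw [← Real.exp_add]; simp
    rw [← this, mul_assoc, h2, mul_one]
  · refine ((hasDerivAt_cliffordK' (-(1 / 2)) hw).mul
      (((Real.hasDerivAt_sqrt hw.ne').const_mul 2).exp)).congr_deriv ?_
    have e1 : - -(1 / 2 : ℝ) - 1 = -(1 / 2) := by norm_num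
    have e2 : (-1 : ℝ) - -(1 / 2) = -(1 / 2) := by norm_num
    rw [e1, e2, Real.rpow_neg hw.le, ← Real.sqrt_eq_rpow]
    ring

/-- The order -1/2 formula, rescaled by 1 + v, writes exp(-2√((1+v)w)) as an integral over y of
exponentials linear in v. After Fubini the v-integral is a Gamma integral. -/
lemma integral_rpow_mul_exp_neg_sqrt {ν : ℝ} (hν : -(1 / 2) < ν) {w : ℝ} (hw : 0 < w) :
    ∫ v in Ioi (0 : ℝ), v ^ (ν - 1 / 2) * ((1 + v) ^ (-(1 / 2) : ℝ) *
      Real.exp (-2 * √((1 + v) * w))) =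
      Real.Gamma (ν + 1 / 2) / √Real.pi * cliffordK ν w := by
  have hinner : ∀ v ∈ Ioi (0 : ℝ), v ^ (ν - 1 / 2) * ((1 + v) ^ (-(1 / 2) : ℝ) *
      Real.exp (-2 * √((1 + v) * w))) = (√Real.pi)⁻¹ * ∫ y in Ioi (0 : ℝ),
        v ^ (ν - 1 / 2) * (y ^ (-(-(1 / 2)) - 1 : ℝ) * Real.exp (-(1 + v) * y - w / y)) := by
    intro v hv
    have hv : 0 < v := hv
    rw [integral_const_mul, integral_rpow_mul_exp_neg_sub_div _ _ (by positivity),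
      cliffordK_neg_half (by positivity)]
    have : √Real.pi ≠ 0 := by positivity
    field_simp
  have houter : ∀ y ∈ Ioi (0 : ℝ), ∫ v in Ioi (0 : ℝ),
      v ^ (ν - 1 / 2) * (y ^ (-(-(1 / 2)) - 1 : ℝ) * Real.exp (-(1 + v) * y - w / y)) =
      Real.Gamma (ν + 1 / 2) * (y ^ (-ν - 1) * Real.exp (-1 * y - w / y)) := by
    intro y hy
    have hy : 0 < y := hy
    have hG := Real.integral_rpow_mul_exp_neg_mul_Ioi (a := ν + 1 / 2) (r := y) (by linarith) hy
    have : ∀ v : ℝ, v ^ (ν - 1 / 2) *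
        (y ^ (-(-(1 / 2)) - 1 : ℝ) * Real.exp (-(1 + v) * y - w / y)) =
        (v ^ (ν + 1 / 2 - 1) * Real.exp (-(y * v))) *
          (y ^ (-(1 / 2) : ℝ) * Real.exp (-1 * y - w / y)) := by
      intro v
      have e : -(1 + v) * y - w / y = -(y * v) + (-1 * y - w / y) := by ring
      rw [e, Real.exp_add]
      ring_nf
    simp_rw [this]
    rw [integral_mul_const, hG, one_div, Real.inv_rpow hy.le, ← Real.rpow_neg hy.le]
    have : y ^ (-ν - 1) = y ^ (-(ν + 1 / 2)) * y ^ (-(1 / 2) : ℝ) := by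
      rw [← Real.rpow_add hy]; ring_nf
    rw [this]
    ring_nf
  have hint : Integrable (Function.uncurry fun v y : ℝ =>
      v ^ (ν - 1 / 2) * (y ^ (-(-(1 / 2)) - 1 : ℝ) * Real.exp (-(1 + v) * y - w / y)))
      ((volume.restrict (Ioi 0)).prod (volume.restrict (Ioi 0))) := by
    have hm : Measurable (Function.uncurry fun v y : ℝ =>
      v ^ (ν - 1 / 2) * (y ^ (-(-(1 / 2)) - 1 : ℝ) * Real.exp (-(1 + v) * y - w / y))) := by
      unfold Function.uncurry; fun_prop
    rw [integrable_prod_iff' hm.aestronglyMeasurable]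
    constructor
    · filter_upwards [ae_restrict_mem measurableSet_Ioi] with y hy
      -- The integral of a non-integrable function is 0 by convention, whereas the value computed in
      -- `houter` is positive.
      by_contra hcon
      have h0 := integral_undef hcon
      simp only [Function.uncurry_apply_pair] at h0
      rw [houter y hy] at h0
      have hy : 0 < y := hy
      have : 0 < Real.Gamma (ν + 1 / 2) := Real.Gamma_pos_of_pos (by linarith)
      have : 0 < Real.Gamma (ν + 1 / 2) * (y ^ (-ν - 1) * Real.exp (-1 * y - w / y)) := by
        positivity
      linarith
    · refine ((integrableOn_cliffordK ν hw).const_mul (Real.Gamma (ν + 1 / 2))).congr ?_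
      filter_upwards [ae_restrict_mem measurableSet_Ioi] with y hy
      rw [← houter y hy]
      refine setIntegral_congr_fun measurableSet_Ioi fun v hv => ?_
      have hy : 0 < y := hy
      have hv : 0 < v := hv
      simp only [Function.uncurry_apply_pair]
      rw [Real.norm_eq_abs, abs_of_nonneg (by positivity)]
  rw [setIntegral_congr_fun measurableSet_Ioi hinner, integral_const_mul,
    integral_integral_swap hint, setIntegral_congr_fun measurableSet_Ioi houter,
    integral_const_mul, ← cliffordK]
  ring

/-! ### Integration on the plane -/

lemma integrable_mul_plane {𝕜 : Type*} [RCLike 𝕜] {f g : ℝ → 𝕜} (hf : Integrable f)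
    (hg : Integrable g) : Integrable fun p : Plane => f (p 0) * g (p 1) := by
  have h := Integrable.fintype_prod (f := ![f, g]) (μ := fun _ : Fin 2 => (volume : Measure ℝ))
    (by intro i; fin_cases i <;> assumption)
  have h2 := (PiLp.volume_preserving_ofLp (Fin 2)).integrable_comp_of_integrable h
  simpa [Function.comp_def, Fin.prod_univ_two] using h2

lemma integral_mul_plane {𝕜 : Type*} [RCLike 𝕜] (f g : ℝ → 𝕜) :
    ∫ p : Plane, f (p 0) * g (p 1) = (∫ x, f x) * ∫ x, g x := by
  have h := integral_fintype_prod_volume_eq_prod (𝕜 := 𝕜) (fun i : Fin 2 => (![f, g] i : ℝ → 𝕜))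
  rw [Fin.prod_univ_two] at h
  rw [← (PiLp.volume_preserving_ofLp (Fin 2)).integral_comp
    (MeasurableEquiv.toLp 2 (Fin 2 → ℝ)).symm.measurableEmbedding] at h
  simpa [Fin.prod_univ_two] using h

lemma ae_coord_ne_zero (i : Fin 2) : ∀ᵐ p : Plane, p i ≠ 0 := by
  have h0 : ∀ᵐ x : ℝ, x ≠ 0 := by simp [ae_iff]
  have h := (PiLp.volume_preserving_ofLp (Fin 2)).quasiMeasurePreserving.ae
    ((Measure.quasiMeasurePreserving_eval (fun _ : Fin 2 => (volume : Measure ℝ)) i).ae h0)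
  exact h

lemma integrable_abs_rpow_neg_mul_inv {a : ℝ} (h0 : 0 ≤ a) (h1 : a < 1) :
    Integrable fun x : ℝ => |x| ^ (-a) * (1 + x ^ 2)⁻¹ := by
  have hpos : IntegrableOn (fun x : ℝ => |x| ^ (-a) * (1 + x ^ 2)⁻¹) (Ioi 0) := by
    rw [← Ioc_union_Ioi_eq_Ioi zero_le_one]
    have hm : Measurable fun x : ℝ => |x| ^ (-a) * (1 + x ^ 2)⁻¹ := by fun_prop
    refine IntegrableOn.union ?_ ?_
    · have := (intervalIntegrable_iff_integrableOn_Ioc_of_le zero_le_one).1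
        (intervalIntegral.intervalIntegrable_rpow' (a := 0) (b := 1) (r := -a) (by linarith))
      refine Integrable.mono' this hm.aestronglyMeasurable ?_
      filter_upwards [ae_restrict_mem measurableSet_Ioc] with x hx
      rw [Real.norm_eq_abs, abs_of_nonneg (by positivity), abs_of_pos hx.1]
      exact mul_le_of_le_one_right (Real.rpow_nonneg hx.1.le _)
        (inv_le_one_of_one_le₀ (by nlinarith [sq_nonneg x]))
    · refine Integrable.mono' integrable_inv_one_add_sq.integrableOn hm.aestronglyMeasurable ?_
      filter_upwards [ae_restrict_mem measurableSet_Ioi] with x hx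
      have hx : 1 < x := hx
      rw [Real.norm_eq_abs, abs_of_nonneg (by positivity), abs_of_pos (by linarith)]
      exact mul_le_of_le_one_left (by positivity)
        (Real.rpow_le_one_of_one_le_of_nonpos hx.le (by linarith))
  have hneg : IntegrableOn (fun x : ℝ => |x| ^ (-a) * (1 + x ^ 2)⁻¹) (Iic 0) := by
    rw [integrableOn_Iic_iff_integrableOn_Iio]
    have h : IntegrableOn (fun x : ℝ => |x| ^ (-a) * (1 + x ^ 2)⁻¹) (Ioi (-0)) := by
      rwa [neg_zero]
    simpa using h.comp_neg_Iio
  rw [← integrableOn_univ, ← Iic_union_Ioi (a := (0 : ℝ))]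
  exact hneg.union hpos

/-- The weight `1 / ((1 + x²) (1 + t²))`, integrable on the plane. -/
noncomputable def planeWeight (p : Plane) : ℝ := (1 + p 0 ^ 2)⁻¹ * (1 + p 1 ^ 2)⁻¹

lemma planeWeight_pos (p : Plane) : 0 < planeWeight p := by unfold planeWeight; positivity

lemma continuous_planeWeight_inv : Continuous fun p : Plane => (planeWeight p)⁻¹ := by
  simp only [planeWeight, mul_inv, inv_inv]; fun_prop

lemma one_add_norm_inv_pow_le (p : Plane) : (1 + ‖p‖) ^ (-(4 : ℝ)) ≤ planeWeight p := by
  have hn : ‖p‖ ^ 2 = p 0 ^ 2 + p 1 ^ 2 := by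
    rw [EuclideanSpace.norm_sq_eq, Fin.sum_univ_two]; simp
  have h4 : (1 + ‖p‖) ^ (-(4 : ℝ)) = ((1 + ‖p‖) ^ 4)⁻¹ := by
    rw [Real.rpow_neg (by positivity)]; norm_cast
  have hb : 1 + ‖p‖ ^ 2 ≤ (1 + ‖p‖) ^ 2 := by nlinarith [norm_nonneg p]
  rw [h4, planeWeight, ← mul_inv]
  apply inv_anti₀ (by positivity)
  calc (1 + p 0 ^ 2) * (1 + p 1 ^ 2) ≤ (1 + ‖p‖) ^ 2 * (1 + ‖p‖) ^ 2 := by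
        apply mul_le_mul <;> first | positivity | nlinarith [sq_nonneg (p 0), sq_nonneg (p 1)]
    _ = (1 + ‖p‖) ^ 4 := by ring

lemma exists_norm_le_mul_planeWeight (φ : 𝓢(Plane, ℂ)) :
    ∃ C : ℝ, ∀ p, ‖φ p‖ ≤ C * planeWeight p := by
  refine ⟨2 ^ 4 * ((Finset.Iic (4, 0)).sup fun m => SchwartzMap.seminorm ℂ m.1 m.2) φ,
    fun p => ?_⟩
  have h := SchwartzMap.one_add_le_sup_seminorm_apply (𝕜 := ℂ) (m := (4, 0)) (k := 4) (n := 0)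
    le_rfl le_rfl φ p
  rw [norm_iteratedFDeriv_zero] at h
  have h1 := one_add_norm_inv_pow_le p
  have h4 : (1 + ‖p‖) ^ (-(4 : ℝ)) = ((1 + ‖p‖) ^ 4)⁻¹ := by
    rw [Real.rpow_neg (by positivity)]; norm_cast
  rw [h4] at h1
  refine le_trans ?_ (mul_le_mul_of_nonneg_left h1 (le_trans (by positivity) h))
  rw [← div_eq_mul_inv, le_div_iff₀ (by positivity), mul_comm]
  exact h

/-- `f` is dominated by a locally integrable product of negative powers of the coordinates. -/
structure CoordPowerBounded (f : Plane → ℝ) : Prop where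
  measurable : Measurable f
  bound : ∃ C a b : ℝ, 0 ≤ a ∧ a < 1 ∧ 0 ≤ b ∧ b < 1 ∧
    ∀ p : Plane, p 0 ≠ 0 → p 1 ≠ 0 → |f p| ≤ C * (|p 0| ^ (-a) * |p 1| ^ (-b))

namespace CoordPowerBounded

variable {f : Plane → ℝ}

lemma integrable_mul_planeWeight (hf : CoordPowerBounded f) :
    Integrable fun p => f p * planeWeight p := by
  obtain ⟨hm, C, a, b, ha0, ha1, hb0, hb1, h⟩ := hf
  refine Integrable.mono' ((integrable_mul_plane (integrable_abs_rpow_neg_mul_inv ha0 ha1)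
    (integrable_abs_rpow_neg_mul_inv hb0 hb1)).const_mul C) ?_ ?_
  · have : Measurable planeWeight := by unfold planeWeight; fun_prop
    exact (hm.mul this).aestronglyMeasurable
  · filter_upwards [ae_coord_ne_zero 0, ae_coord_ne_zero 1] with p h0 h1
    rw [norm_mul, Real.norm_eq_abs, Real.norm_eq_abs, abs_of_pos (planeWeight_pos p)]
    refine (mul_le_mul_of_nonneg_right (h p h0 h1) (planeWeight_pos p).le).trans (le_of_eq ?_)
    rw [planeWeight]; ring

lemma locallyIntegrable (hf : CoordPowerBounded f) : LocallyIntegrable f := by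
  refine (hf.integrable_mul_planeWeight.locallyIntegrable.mul_continuous
    continuous_planeWeight_inv).congr (ae_of_all _ fun p => ?_)
  exact mul_inv_cancel_right₀ (planeWeight_pos p).ne' _

lemma integrable_norm_mul (hf : CoordPowerBounded f) (φ : 𝓢(Plane, ℂ)) :
    Integrable fun p => ‖φ p‖ * f p := by
  obtain ⟨C, hC⟩ := exists_norm_le_mul_planeWeight φ
  refine Integrable.mono' (hf.integrable_mul_planeWeight.norm.const_mul C)
    (φ.continuous.norm.measurable.mul hf.measurable).aestronglyMeasurable (ae_of_all _ fun p => ?_)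
  rw [norm_mul, norm_norm, norm_mul, Real.norm_eq_abs (planeWeight p),
    abs_of_pos (planeWeight_pos p)]
  calc ‖φ p‖ * ‖f p‖ ≤ (C * planeWeight p) * ‖f p‖ := by gcongr; exact hC p
    _ = _ := by ring

lemma integrable_mul (hf : CoordPowerBounded f) (φ : 𝓢(Plane, ℂ)) :
    Integrable fun p => φ p * (f p : ℂ) := by
  refine (hf.integrable_norm_mul φ).mono (φ.continuous.measurable.mul
    (Complex.measurable_ofReal.comp hf.measurable)).aestronglyMeasurable (ae_of_all _ fun p => ?_)
  simp

/-- The tempered distribution `φ ↦ ∫ φ f`. -/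
lemma exists_isGivenBy (hf : CoordPowerBounded f) (h0 : ∀ p, 0 ≤ f p) :
    ∃ T : 𝓢'(Plane, ℂ), IsGivenBy T f := by
  have hm : Measurable fun p => ENNReal.ofReal (f p) := hf.measurable.ennreal_ofReal
  have hfin : ∀ᵐ p : Plane, ENNReal.ofReal (f p) < ⊤ := ae_of_all _ fun p => ENNReal.ofReal_lt_top
  have : (volume.withDensity fun p => ENNReal.ofReal (f p)).HasTemperateGrowth := by
    -- The exponent 4 is the one for which (1+‖p‖)^(-4) is below `planeWeight`.
    refine ⟨4, ?_⟩
    rw [integrable_withDensity_iff_integrable_smul' hm hfin]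
    refine hf.integrable_mul_planeWeight.mono' ?_ (ae_of_all _ fun p => ?_)
    · refine (hm.ennreal_toReal.smul ?_).aestronglyMeasurable
      fun_prop
    · rw [norm_smul, ENNReal.toReal_ofReal (h0 p), Real.norm_eq_abs, Real.norm_eq_abs,
        abs_of_nonneg (h0 p), abs_of_nonneg (by positivity)]
      exact mul_le_mul_of_nonneg_left (by simpa using one_add_norm_inv_pow_le p) (h0 p)
  refine ⟨(volume.withDensity fun p => ENNReal.ofReal (f p)).toTemperedDistribution,
    hf.locallyIntegrable, fun φ => ⟨hf.integrable_mul φ, ?_⟩⟩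
  refine (Measure.toTemperedDistribution_apply _ φ).trans ?_
  rw [integral_withDensity_eq_integral_toReal_smul hm hfin]
  refine integral_congr_ae (ae_of_all _ fun p => ?_)
  simp only [ENNReal.toReal_ofReal (h0 p), Complex.real_smul]
  rw [mul_comm]

end CoordPowerBounded

lemma koranyiKernel_nonneg (s : ℝ) (p : Plane) : 0 ≤ koranyiKernel s p := by
  unfold koranyiKernel; positivity

/-- Weighted AM-GM with weights 1/3 and 2/3 gives |x t|^(4/3) ≤ x⁴ + t², so both coordinates receive
the exponent s/3, which is below 1 exactly when s < 3. -/
lemma coordPowerBounded_koranyiKernel {s : ℝ} (hs0 : 0 < s) (hs3 : s < 3) :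
    CoordPowerBounded (koranyiKernel s) := by
  refine ⟨by unfold koranyiKernel; fun_prop, 1, s / 3, s / 3, by positivity, by linarith,
    by positivity, by linarith, fun p h0 h1 => ?_⟩
  have hx : 0 < |p 0| := abs_pos.2 h0
  have ht : 0 < |p 1| := abs_pos.2 h1
  rw [abs_of_nonneg (koranyiKernel_nonneg s p), one_mul, koranyiKernel, one_div,
    ← Real.mul_rpow hx.le ht.le, Real.rpow_neg (by positivity)]
  apply inv_anti₀ (by positivity)
  have h := Real.geom_mean_le_arith_mean2_weighted (w₁ := 1 / 3) (w₂ := 2 / 3)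
    (p₁ := |p 0| ^ (4 : ℝ)) (p₂ := |p 1| ^ (2 : ℝ)) (by norm_num) (by norm_num) (by positivity)
    (by positivity) (by norm_num)
  rw [← Real.rpow_mul hx.le, ← Real.rpow_mul ht.le] at h
  have e4 : |p 0| ^ (4 : ℝ) = p 0 ^ 4 := by
    rw [show (4 : ℝ) = ((4 : ℕ) : ℝ) by norm_num, Real.rpow_natCast]
    exact (by decide : Even 4).pow_abs _
  have e2 : |p 1| ^ (2 : ℝ) = p 1 ^ 2 := by rw [Real.rpow_two, sq_abs]
  rw [e4, e2] at h
  have h' : (|p 0| * |p 1|) ^ (4 / 3 : ℝ) ≤ p 0 ^ 4 + p 1 ^ 2 := by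
    rw [Real.mul_rpow hx.le ht.le]
    norm_num at h ⊢
    have : 0 ≤ p 0 ^ 4 := by positivity
    nlinarith [sq_nonneg (p 1)]
  calc (|p 0| * |p 1|) ^ (s / 3) = ((|p 0| * |p 1|) ^ (4 / 3 : ℝ)) ^ (s / 4) := by
        rw [← Real.rpow_mul (by positivity)]; ring_nf
    _ ≤ _ := Real.rpow_le_rpow (by positivity) h' (by positivity)

/-! ### One-dimensional integrals -/

/-- The Gamma integral after v ↦ v^(-q). The case q = 1 serves the integrals over l, and q = 1/2 the
tail of `poissonProfile`. -/
lemma integrableOn_and_integral_rpow_mul_exp_neg_mul_rpow_neg {a r q : ℝ} (ha : 0 < a) (hr : 0 < r)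
    (hq : 0 < q) :
    IntegrableOn (fun v : ℝ => v ^ (-(a * q) - 1) * Real.exp (-r * v ^ (-q))) (Ioi 0) ∧
      ∫ v in Ioi (0 : ℝ), v ^ (-(a * q) - 1) * Real.exp (-r * v ^ (-q)) =
        q⁻¹ * Real.Gamma a * r ^ (-a) := by
  have hint := integrableOn_rpow_mul_exp_neg_mul_rpow (p := 1) (s := a - 1) (b := r)
    (by linarith) one_pos hr
  have hval := Real.integral_rpow_mul_exp_neg_mul_Ioi (a := a) (r := r) ha hr
  have hqn : -q ≠ 0 := by linarith
  rw [← integrableOn_Ioi_comp_rpow_iff _ hqn] at hint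
  rw [← integral_comp_rpow_Ioi _ hqn] at hval
  have hcongr : ∀ v ∈ Ioi (0 : ℝ), (|-q| * v ^ (-q - 1)) •
      ((v ^ (-q)) ^ (a - 1) * Real.exp (-r * (v ^ (-q)) ^ (1 : ℝ))) =
      q * (v ^ (-(a * q) - 1) * Real.exp (-r * v ^ (-q))) := by
    intro v hv
    have hv : 0 < v := hv
    have : v ^ (-(a * q) - 1) = v ^ (-q - 1) * v ^ (-q * (a - 1)) := by
      rw [← Real.rpow_add hv]; ring_nf
    rw [Real.rpow_one, ← Real.rpow_mul hv.le, this, abs_neg, abs_of_pos hq, smul_eq_mul]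
    ring
  constructor
  · have h2 := (hint.congr_fun hcongr measurableSet_Ioi).const_mul q⁻¹
    refine IntegrableOn.congr_fun h2 (fun v _ => ?_) measurableSet_Ioi
    exact inv_mul_cancel_left₀ hq.ne' _
  · have h2 : ∫ v in Ioi (0 : ℝ), q * (v ^ (-(a * q) - 1) * Real.exp (-r * v ^ (-q))) =
        (1 / r) ^ a * Real.Gamma a := by
      rw [← hval]
      refine setIntegral_congr_fun measurableSet_Ioi fun v hv => ?_
      rw [← hcongr v hv]
      simp
    rw [integral_const_mul] at h2
    rw [Real.rpow_neg hr.le, ← Real.inv_rpow hr.le, ← one_div r, mul_assoc, mul_comm (Real.Gamma a),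
      ← h2, inv_mul_cancel_left₀ hq.ne']

lemma integrableOn_rpow_mul_exp_neg_div {a w : ℝ} (ha : 0 < a) (hw : 0 < w) :
    IntegrableOn (fun l : ℝ => l ^ (-a - 1) * Real.exp (-(w / l))) (Ioi 0) := by
  have h := (integrableOn_and_integral_rpow_mul_exp_neg_mul_rpow_neg ha hw one_pos).1
  simpa [Real.rpow_neg_one, div_eq_mul_inv] using h

lemma integral_rpow_mul_exp_neg_div {a w : ℝ} (ha : 0 < a) (hw : 0 < w) :
    ∫ l in Ioi (0 : ℝ), l ^ (-a - 1) * Real.exp (-(w / l)) = Real.Gamma a * w ^ (-a) := by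
  have h := (integrableOn_and_integral_rpow_mul_exp_neg_mul_rpow_neg ha hw one_pos).2
  simpa [Real.rpow_neg_one, div_eq_mul_inv] using h

lemma integrable_exp_neg_mul_pow_four {l : ℝ} (hl : 0 < l) :
    Integrable fun x : ℝ => Real.exp (-l * x ^ 4) := by
  refine ((integrable_exp_neg_mul_sq hl).const_mul (Real.exp l)).mono'
    (by fun_prop : Continuous fun x : ℝ => Real.exp (-l * x ^ 4)).aestronglyMeasurable
    (ae_of_all _ fun x => ?_)
  rw [Real.norm_eq_abs, Real.abs_exp, ← Real.exp_add]
  apply Real.exp_le_exp.2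
  nlinarith [mul_nonneg hl.le (sq_nonneg (x ^ 2 - 1)), mul_nonneg hl.le (sq_nonneg x)]

lemma integral_exp_neg_mul_pow_four {l : ℝ} (hl : 0 < l) :
    ∫ x : ℝ, Real.exp (-l * x ^ 4) = l ^ (-(1 / 4) : ℝ) * ∫ x : ℝ, Real.exp (-1 * x ^ 4) := by
  have h := Measure.integral_comp_mul_left (fun x : ℝ => Real.exp (-1 * x ^ 4)) (l ^ (1 / 4 : ℝ))
  have e : (l ^ (1 / 4 : ℝ)) ^ 4 = l := by
    rw [← Real.rpow_natCast, ← Real.rpow_mul hl.le]; norm_num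
  simp_rw [mul_pow, e] at h
  rw [abs_of_pos (by positivity), ← Real.rpow_neg hl.le, smul_eq_mul] at h
  rw [← h]
  refine integral_congr_ae (ae_of_all _ fun x => ?_)
  simp only
  ring_nf

/-! ### The Fourier transform of `exp(-l (x⁴ + t²))` -/

/-- The Fourier transform of `exp(-l x⁴)`. -/
noncomputable def quarticFourier (l ξ : ℝ) : ℂ :=
  ∫ x : ℝ, Complex.exp (-2 * (Real.pi : ℂ) * Complex.I * (x : ℂ) * (ξ : ℂ)) *
    ((Real.exp (-l * x ^ 4) : ℝ) : ℂ)

lemma norm_exp_neg_two_pi_I (x ξ : ℝ) :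
    ‖Complex.exp (-2 * (Real.pi : ℂ) * Complex.I * (x : ℂ) * (ξ : ℂ))‖ = 1 := by
  have : -2 * (Real.pi : ℂ) * Complex.I * (x : ℂ) * (ξ : ℂ) =
      ((-2 * Real.pi * x * ξ : ℝ) : ℂ) * Complex.I := by push_cast; ring
  rw [this, Complex.norm_exp_ofReal_mul_I]

lemma norm_quarticFourier_le {l : ℝ} (hl : 0 < l) (ξ : ℝ) :
    ‖quarticFourier l ξ‖ ≤ l ^ (-(1 / 4) : ℝ) * ∫ x : ℝ, Real.exp (-1 * x ^ 4) := by
  rw [← integral_exp_neg_mul_pow_four hl]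
  refine (norm_integral_le_integral_norm _).trans (le_of_eq ?_)
  refine integral_congr_ae (ae_of_all _ fun x => ?_)
  simp only [norm_mul, norm_exp_neg_two_pi_I, one_mul, Complex.norm_real, Real.norm_eq_abs,
    Real.abs_exp]

lemma measurable_quarticFourier : Measurable (Function.uncurry quarticFourier) := by
  refine (StronglyMeasurable.integral_prod_right (f := fun (q : ℝ × ℝ) (x : ℝ) =>
    Complex.exp (-2 * (Real.pi : ℂ) * Complex.I * (x : ℂ) * (q.2 : ℂ)) *
    ((Real.exp (-q.1 * x ^ 4) : ℝ) : ℂ)) ?_).measurable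
  refine Continuous.stronglyMeasurable ?_
  unfold Function.uncurry
  fun_prop

lemma integral_cexp_mul_gaussian {k : ℝ} (hk : 0 < k) (ξ : ℝ) :
    ∫ x : ℝ, Complex.exp (-2 * (Real.pi : ℂ) * Complex.I * (x : ℂ) * (ξ : ℂ)) *
      ((Real.exp (-k * x ^ 2) : ℝ) : ℂ) =
      ((√(Real.pi / k) * Real.exp (-(Real.pi ^ 2 * ξ ^ 2 / k)) : ℝ) : ℂ) := by
  have h := fourierIntegral_gaussian (b := (k : ℂ)) (by simpa using hk)
    ((-2 * Real.pi * ξ : ℝ) : ℂ)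
  have hs : ((Real.pi : ℂ) / (k : ℂ)) ^ (1 / 2 : ℂ) = ((√(Real.pi / k) : ℝ) : ℂ) := by
    rw [Real.sqrt_eq_rpow, Complex.ofReal_cpow (by positivity)]
    push_cast; rfl
  rw [hs] at h
  push_cast at h ⊢
  convert h using 2
  · ext x
    congr 2
    ring
  · congr 1
    have : (k : ℂ) ≠ 0 := by exact_mod_cast hk.ne'
    field_simp
    ring

lemma fourier_exp_neg_mul_pow_four_add_sq {l : ℝ} (hl : 0 < l) (ξ : Plane) :
    𝓕 (fun p : Plane => ((Real.exp (-l * (p 0 ^ 4 + p 1 ^ 2)) : ℝ) : ℂ)) ξ =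
      quarticFourier l (ξ 0) *
        ((√(Real.pi / l) * Real.exp (-(Real.pi ^ 2 * ξ 1 ^ 2 / l)) : ℝ) : ℂ) := by
  rw [Real.fourier_eq', ← integral_cexp_mul_gaussian hl, quarticFourier, ← integral_mul_plane]
  refine integral_congr_ae (ae_of_all _ fun p => ?_)
  have hi : inner ℝ p ξ = p 0 * ξ 0 + p 1 * ξ 1 := by
    rw [PiLp.inner_apply, Fin.sum_univ_two]
    simp [mul_comm]
  simp only [hi, smul_eq_mul]
  rw [mul_mul_mul_comm, ← Complex.exp_add, ← Complex.ofReal_mul, ← Real.exp_add]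
  congr 2
  · push_cast; ring
  · ring_nf

/-- The multiplication formula ∫ φ̂ g = ∫ φ ĝ, which needs only integrability of φ and g. -/
lemma integral_fourier_mul_exp_neg {l : ℝ} (hl : 0 < l) (φ : 𝓢(Plane, ℂ)) :
    ∫ p : Plane, 𝓕 φ p * ((Real.exp (-l * (p 0 ^ 4 + p 1 ^ 2)) : ℝ) : ℂ) =
      ∫ ξ : Plane, φ ξ * (quarticFourier l (ξ 0) *
        ((√(Real.pi / l) * Real.exp (-(Real.pi ^ 2 * ξ 1 ^ 2 / l)) : ℝ) : ℂ)) := by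
  have hint : Integrable fun p : Plane =>
      ((Real.exp (-l * (p 0 ^ 4 + p 1 ^ 2)) : ℝ) : ℂ) := by
    refine Integrable.ofReal ?_
    refine (integrable_mul_plane (integrable_exp_neg_mul_pow_four hl)
      (integrable_exp_neg_mul_sq hl)).congr (ae_of_all _ fun p => ?_)
    simp only
    rw [← Real.exp_add, ← mul_add]
    rfl
  have h := VectorFourier.integral_fourierIntegral_smul_eq_flip (L := innerₗ Plane)
      (μ := volume) (ν := volume) Real.continuous_fourierChar continuous_inner
      (φ.integrable (μ := volume)) hint
  simp_rw [← fourier_exp_neg_mul_pow_four_add_sq hl]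
  simpa [SchwartzMap.fourier_coe] using! h

/-! ### The Fourier transform of the Korányi kernel as a superposition -/

lemma integral_rpow_mul_exp_neg_mul_koranyi {s : ℝ} (hs : 0 < s) {p : Plane} (h1 : p 1 ≠ 0) :
    ∫ l in Ioi (0 : ℝ), l ^ (s / 4 - 1) * Real.exp (-l * (p 0 ^ 4 + p 1 ^ 2)) =
      Real.Gamma (s / 4) * koranyiKernel s p := by
  have hr : 0 < p 0 ^ 4 + p 1 ^ 2 := by positivity
  have h := Real.integral_rpow_mul_exp_neg_mul_Ioi (a := s / 4) (by positivity) hr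
  rw [koranyiKernel, mul_comm (Real.Gamma _), one_div, ← Real.inv_rpow hr.le, ← one_div, ← h]
  refine setIntegral_congr_fun measurableSet_Ioi fun l _ => ?_
  simp only
  congr 2
  ring

lemma integrableOn_rpow_mul_exp_neg_mul_koranyi {s : ℝ} (hs : 0 < s) {p : Plane} (h1 : p 1 ≠ 0) :
    IntegrableOn (fun l : ℝ => l ^ (s / 4 - 1) * Real.exp (-l * (p 0 ^ 4 + p 1 ^ 2))) (Ioi 0) := by
  have hr : 0 < p 0 ^ 4 + p 1 ^ 2 := by positivity
  refine (integrableOn_rpow_mul_exp_neg_mul_rpow (p := 1) (s := s / 4 - 1)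
    (b := p 0 ^ 4 + p 1 ^ 2) (by linarith) one_pos hr).congr_fun (fun l _ => ?_) measurableSet_Ioi
  simp only [Real.rpow_one]
  congr 2
  ring

lemma integral_mul_koranyiKernel {s : ℝ} (hs0 : 0 < s) (hs3 : s < 3) (ψ : 𝓢(Plane, ℂ)) :
    (Real.Gamma (s / 4) : ℂ) * ∫ p : Plane, ψ p * (koranyiKernel s p : ℂ) =
      ∫ l in Ioi (0 : ℝ), ((l ^ (s / 4 - 1) : ℝ) : ℂ) *
        ∫ p : Plane, ψ p * ((Real.exp (-l * (p 0 ^ 4 + p 1 ^ 2)) : ℝ) : ℂ) := by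
  -- Integrating the norm over l gives Γ(s/4) ‖ψ‖ f_s, already known to be integrable.
  have hint : Integrable (Function.uncurry fun (p : Plane) (l : ℝ) => ψ p *
      ((l ^ (s / 4 - 1) * Real.exp (-l * (p 0 ^ 4 + p 1 ^ 2)) : ℝ) : ℂ))
      (volume.prod (volume.restrict (Ioi 0))) := by
    have hm : Measurable (Function.uncurry fun (p : Plane) (l : ℝ) => ψ p *
        ((l ^ (s / 4 - 1) * Real.exp (-l * (p 0 ^ 4 + p 1 ^ 2)) : ℝ) : ℂ)) := by
      have := ψ.continuous.measurable
      unfold Function.uncurry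
      fun_prop
    rw [integrable_prod_iff hm.aestronglyMeasurable]
    constructor
    · filter_upwards [ae_coord_ne_zero 1] with p h1
      exact (Integrable.ofReal (𝕜 := ℂ) (integrableOn_rpow_mul_exp_neg_mul_koranyi hs0 h1)).const_mul
        (ψ p)
    · refine (((coordPowerBounded_koranyiKernel hs0 hs3).integrable_norm_mul ψ).const_mul
        (Real.Gamma (s / 4))).congr ?_
      filter_upwards [ae_coord_ne_zero 1] with p h1
      rw [mul_left_comm, ← integral_rpow_mul_exp_neg_mul_koranyi hs0 h1, ← integral_const_mul]
      refine setIntegral_congr_fun measurableSet_Ioi fun l hl => ?_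
      have hl : 0 < l := hl
      simp only [Function.uncurry_apply_pair, norm_mul, Complex.norm_real]
      rw [Real.norm_eq_abs, abs_of_nonneg (by positivity), Real.norm_eq_abs, Real.abs_exp]
  have h1 : (Real.Gamma (s / 4) : ℂ) * ∫ p : Plane, ψ p * (koranyiKernel s p : ℂ) =
      ∫ p : Plane, ∫ l in Ioi (0 : ℝ), ψ p *
      ((l ^ (s / 4 - 1) * Real.exp (-l * (p 0 ^ 4 + p 1 ^ 2)) : ℝ) : ℂ) := by
    rw [← integral_const_mul]
    refine integral_congr_ae ?_
    filter_upwards [ae_coord_ne_zero 1] with p h1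
    rw [integral_const_mul, integral_complex_ofReal, integral_rpow_mul_exp_neg_mul_koranyi hs0 h1]
    push_cast
    ring
  rw [h1, integral_integral_swap hint]
  refine setIntegral_congr_fun measurableSet_Ioi fun l _ => ?_
  simp only
  rw [← integral_const_mul]
  refine integral_congr_ae (ae_of_all _ fun p => ?_)
  push_cast
  ring

/-- The superposition over `l` of the Fourier transforms of `exp(-l (x⁴ + t²))`. -/
noncomputable def quarticSuperposition (s : ℝ) (ξ : Plane) : ℂ :=
  ∫ l in Ioi (0 : ℝ), ((l ^ (s / 4 - 1) : ℝ) : ℂ) * (quarticFourier l (ξ 0) *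
    ((√(Real.pi / l) * Real.exp (-(Real.pi ^ 2 * ξ 1 ^ 2 / l)) : ℝ) : ℂ))

lemma rpow_mul_sqrt_pi_div (s : ℝ) {l : ℝ} (hl : 0 < l) :
    l ^ (s / 4 - 1) * √(Real.pi / l) = √Real.pi * l ^ (s / 4 - 3 / 2) := by
  have : l ^ (s / 4 - 3 / 2) = l ^ (s / 4 - 1) / √l := by
    rw [Real.sqrt_eq_rpow, ← Real.rpow_sub hl]; ring_nf
  rw [Real.sqrt_div Real.pi_pos.le, this]; ring

/-- Scaling costs l^(-1/4) for the quartic factor and l^(-1/2) for the Gaussian one; together with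
l^(s/4-1) they make the exponent -(3-s)/4 - 1. -/
lemma norm_superposition_term_le (s : ℝ) {l : ℝ} (hl : 0 < l) (x τ : ℝ) :
    ‖((l ^ (s / 4 - 1) : ℝ) : ℂ) * (quarticFourier l x *
      ((√(Real.pi / l) * Real.exp (-(Real.pi ^ 2 * τ ^ 2 / l)) : ℝ) : ℂ))‖ ≤
      (√Real.pi * ∫ x : ℝ, Real.exp (-1 * x ^ 4)) *
        (l ^ (-((3 - s) / 4) - 1) * Real.exp (-(Real.pi ^ 2 * τ ^ 2 / l))) := by
  rw [norm_mul, norm_mul, Complex.norm_real, Complex.norm_real, Real.norm_eq_abs, Real.norm_eq_abs,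
    abs_of_nonneg (by positivity), abs_of_nonneg (by positivity)]
  have e : l ^ (-((3 - s) / 4) - 1) = l ^ (s / 4 - 3 / 2) * l ^ (-(1 / 4) : ℝ) := by
    rw [← Real.rpow_add hl]; ring_nf
  calc l ^ (s / 4 - 1) * (‖quarticFourier l x‖ *
        (√(Real.pi / l) * Real.exp (-(Real.pi ^ 2 * τ ^ 2 / l))))
      ≤ l ^ (s / 4 - 1) * ((l ^ (-(1 / 4) : ℝ) * ∫ x : ℝ, Real.exp (-1 * x ^ 4)) *
        (√(Real.pi / l) * Real.exp (-(Real.pi ^ 2 * τ ^ 2 / l)))) := by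
        gcongr; exact norm_quarticFourier_le hl x
    _ = (l ^ (s / 4 - 1) * √(Real.pi / l)) * l ^ (-(1 / 4) : ℝ) *
        (∫ x : ℝ, Real.exp (-1 * x ^ 4)) * Real.exp (-(Real.pi ^ 2 * τ ^ 2 / l)) := by ring
    _ = _ := by rw [rpow_mul_sqrt_pi_div s hl, e]; ring

lemma coordPowerBounded_abs_rpow {b : ℝ} (h0 : 0 ≤ b) (h1 : b < 1) (C : ℝ) :
    CoordPowerBounded fun p => C * |p 1| ^ (-b) := by
  refine ⟨by fun_prop, |C|, 0, b, le_rfl, one_pos, h0, h1, fun p _ _ => ?_⟩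
  rw [abs_mul, abs_of_nonneg (by positivity : 0 ≤ |p 1| ^ (-b))]
  simp

lemma integral_fourier_mul_koranyiKernel {s : ℝ} (hs1 : 1 < s) (hs3 : s < 3) (φ : 𝓢(Plane, ℂ)) :
    (Real.Gamma (s / 4) : ℂ) * ∫ p : Plane, 𝓕 φ p * (koranyiKernel s p : ℂ) =
      ∫ ξ : Plane, φ ξ * quarticSuperposition s ξ := by
  have h3s : 0 < (3 - s) / 4 := by linarith
  rw [integral_mul_koranyiKernel (by linarith) hs3]
  set A : ℝ := √Real.pi * ∫ x : ℝ, Real.exp (-1 * x ^ 4)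
  have hmaj : Integrable (Function.uncurry fun (l : ℝ) (ξ : Plane) => ‖φ ξ‖ * (A *
      (l ^ (-((3 - s) / 4) - 1) * Real.exp (-(Real.pi ^ 2 * ξ 1 ^ 2 / l)))))
      ((volume.restrict (Ioi 0)).prod volume) := by
    have hm : Measurable (Function.uncurry fun (l : ℝ) (ξ : Plane) => ‖φ ξ‖ * (A *
        (l ^ (-((3 - s) / 4) - 1) * Real.exp (-(Real.pi ^ 2 * ξ 1 ^ 2 / l))))) := by
      have := φ.continuous.measurable
      unfold Function.uncurry
      fun_prop
    rw [integrable_prod_iff' hm.aestronglyMeasurable]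
    constructor
    · filter_upwards [ae_coord_ne_zero 1] with ξ h1
      have hw : 0 < Real.pi ^ 2 * ξ 1 ^ 2 := by positivity
      exact ((integrableOn_rpow_mul_exp_neg_div h3s hw).const_mul A).const_mul ‖φ ξ‖
    -- The l-integral of the majorant is a multiple of |ξ₂|^(-(3-s)/2); the hypothesis s > 1 is what
    -- puts this exponent below 1.
    · refine ((coordPowerBounded_abs_rpow (b := (3 - s) / 2) (by linarith) (by linarith)
        (|A| * Real.Gamma ((3 - s) / 4) * Real.pi ^ (-((3 - s) / 2)))).integrable_norm_mul
        φ).congr ?_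
      filter_upwards [ae_coord_ne_zero 1] with ξ h1
      have e : Real.pi ^ (-((3 - s) / 2)) * |ξ 1| ^ (-((3 - s) / 2)) =
          (Real.pi ^ 2 * ξ 1 ^ 2) ^ (-((3 - s) / 4)) := by
        rw [← Real.mul_rpow (by positivity) (by positivity), ← sq_abs (ξ 1), ← mul_pow,
          ← Real.rpow_two, ← Real.rpow_mul (by positivity)]
        ring_nf
      have hw : 0 < Real.pi ^ 2 * ξ 1 ^ 2 := by positivity
      rw [mul_assoc (|A| * _), e, mul_assoc |A|, ← integral_rpow_mul_exp_neg_div h3s hw,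
        ← integral_const_mul, ← integral_const_mul]
      refine setIntegral_congr_fun measurableSet_Ioi fun l hl => ?_
      have hl : 0 < l := hl
      simp only [Function.uncurry_apply_pair, norm_mul, norm_norm]
      simp only [Real.norm_eq_abs, Real.abs_exp]
      rw [abs_of_pos (Real.rpow_pos_of_pos hl _)]
  have hint : Integrable (Function.uncurry fun (l : ℝ) (ξ : Plane) => φ ξ *
      (((l ^ (s / 4 - 1) : ℝ) : ℂ) * (quarticFourier l (ξ 0) *
      ((√(Real.pi / l) * Real.exp (-(Real.pi ^ 2 * ξ 1 ^ 2 / l)) : ℝ) : ℂ))))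
      ((volume.restrict (Ioi 0)).prod volume) := by
    refine hmaj.mono' ?_ ?_
    · have h1 := φ.continuous.measurable
      have h2 : Measurable fun q : ℝ × Plane => quarticFourier q.1 (q.2 0) :=
        measurable_quarticFourier.comp (by fun_prop : Measurable fun q : ℝ × Plane => (q.1, q.2 0))
      refine Measurable.aestronglyMeasurable ?_
      unfold Function.uncurry
      fun_prop
    · have : ∀ᵐ q : ℝ × Plane ∂((volume.restrict (Ioi (0 : ℝ))).prod volume), 0 < q.1 :=
        Measure.quasiMeasurePreserving_fst.ae (ae_restrict_mem measurableSet_Ioi)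
      filter_upwards [this] with q hq
      simp only [Function.uncurry]
      rw [norm_mul]
      exact mul_le_mul_of_nonneg_left (norm_superposition_term_le s hq _ _) (norm_nonneg _)
  have h1 : ∀ l ∈ Ioi (0 : ℝ), ((l ^ (s / 4 - 1) : ℝ) : ℂ) *
      ∫ p : Plane, 𝓕 φ p * ((Real.exp (-l * (p 0 ^ 4 + p 1 ^ 2)) : ℝ) : ℂ) =
      ∫ ξ : Plane, φ ξ * (((l ^ (s / 4 - 1) : ℝ) : ℂ) * (quarticFourier l (ξ 0) *
      ((√(Real.pi / l) * Real.exp (-(Real.pi ^ 2 * ξ 1 ^ 2 / l)) : ℝ) : ℂ))) := by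
    intro l hl
    rw [integral_fourier_mul_exp_neg hl, ← integral_const_mul]
    refine integral_congr_ae (ae_of_all _ fun p => ?_)
    simp only
    ring
  rw [setIntegral_congr_fun measurableSet_Ioi h1, integral_integral_swap hint]
  refine integral_congr_ae (ae_of_all _ fun ξ => ?_)
  simp only
  rw [integral_const_mul, quarticSuperposition]

/-! ### Bessel form -/

/-- For fixed `τ ≠ 0`, the inner integral over `l` is a Bessel-type function of `x`. -/
lemma integral_rpow_mul_exp_quartic (s : ℝ) {x τ : ℝ} (hx : x ≠ 0) (hτ : τ ≠ 0) :
    ∫ l in Ioi (0 : ℝ), l ^ (s / 4 - 3 / 2) *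
      (Real.exp (-(Real.pi ^ 2 * τ ^ 2 / l)) * Real.exp (-l * x ^ 4)) =
      (Real.pi * |τ|) ^ ((s - 2) / 2) * cliffordK ((s - 2) / 4) (x ^ 4 * (Real.pi ^ 2 * τ ^ 2)) := by
  have hx4 : 0 < x ^ 4 := by positivity
  have hw : 0 < Real.pi ^ 2 * τ ^ 2 := by positivity
  -- The order -(s-2)/4 matches the power l^(s/4-3/2); reflecting it to (s-2)/4 then cancels the
  -- power of x in front.
  have h := integral_rpow_mul_exp_neg_sub_div (-((s - 2) / 4)) (Real.pi ^ 2 * τ ^ 2) hx4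
  rw [cliffordK_eq_rpow_mul _ (by positivity), ← mul_assoc, neg_neg,
    Real.mul_rpow hx4.le hw.le, ← mul_assoc, ← Real.rpow_add hx4, neg_add_cancel, Real.rpow_zero,
    one_mul] at h
  have e : (Real.pi * |τ|) ^ ((s - 2) / 2) = (Real.pi ^ 2 * τ ^ 2) ^ ((s - 2) / 4) := by
    rw [← sq_abs τ, ← mul_pow, ← Real.rpow_two, ← Real.rpow_mul (by positivity)]
    ring_nf
  rw [e, ← h]
  refine setIntegral_congr_fun measurableSet_Ioi fun l _ => ?_
  rw [← Real.exp_add]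
  ring_nf

lemma integrable_prod_quartic {s : ℝ} (hs3 : s < 3) {τ : ℝ} (hτ : τ ≠ 0) (ξ : ℝ) :
    Integrable (Function.uncurry fun (l x : ℝ) =>
      Complex.exp (-2 * (Real.pi : ℂ) * Complex.I * (x : ℂ) * (ξ : ℂ)) *
      ((l ^ (s / 4 - 3 / 2) * (Real.exp (-(Real.pi ^ 2 * τ ^ 2 / l)) *
        Real.exp (-l * x ^ 4)) : ℝ) : ℂ)) ((volume.restrict (Ioi 0)).prod volume) := by
  have hm : Measurable (Function.uncurry fun (l x : ℝ) =>
      Complex.exp (-2 * (Real.pi : ℂ) * Complex.I * (x : ℂ) * (ξ : ℂ)) *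
      ((l ^ (s / 4 - 3 / 2) * (Real.exp (-(Real.pi ^ 2 * τ ^ 2 / l)) *
        Real.exp (-l * x ^ 4)) : ℝ) : ℂ)) := by
    unfold Function.uncurry; fun_prop
  have hw : 0 < Real.pi ^ 2 * τ ^ 2 := by positivity
  rw [integrable_prod_iff hm.aestronglyMeasurable]
  constructor
  · filter_upwards [ae_restrict_mem measurableSet_Ioi] with l hl
    refine (((integrable_exp_neg_mul_pow_four hl).const_mul (l ^ (s / 4 - 3 / 2) *
      Real.exp (-(Real.pi ^ 2 * τ ^ 2 / l))))).mono'
      (hm.comp measurable_prodMk_left).aestronglyMeasurable (ae_of_all _ fun x => ?_)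
    have hl : 0 < l := hl
    simp only [Function.uncurry_apply_pair]
    rw [norm_mul, norm_exp_neg_two_pi_I, one_mul, Complex.norm_real, Real.norm_eq_abs,
      abs_of_nonneg (by positivity), mul_assoc]
  · refine ((integrableOn_rpow_mul_exp_neg_div (a := (3 - s) / 4) (by linarith) hw).const_mul
      (∫ x : ℝ, Real.exp (-1 * x ^ 4))).congr ?_
    filter_upwards [ae_restrict_mem measurableSet_Ioi] with l hl
    have hl : 0 < l := hl
    have e : l ^ (-((3 - s) / 4) - 1) = l ^ (s / 4 - 3 / 2) * l ^ (-(1 / 4) : ℝ) := by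
      rw [← Real.rpow_add hl]; ring_nf
    have : ∀ x : ℝ, ‖Function.uncurry (fun (l x : ℝ) =>
        Complex.exp (-2 * (Real.pi : ℂ) * Complex.I * (x : ℂ) * (ξ : ℂ)) *
        ((l ^ (s / 4 - 3 / 2) * (Real.exp (-(Real.pi ^ 2 * τ ^ 2 / l)) *
        Real.exp (-l * x ^ 4)) : ℝ) : ℂ)) (l, x)‖ =
        (l ^ (s / 4 - 3 / 2) * Real.exp (-(Real.pi ^ 2 * τ ^ 2 / l))) *
          Real.exp (-l * x ^ 4) := by
      intro x
      simp only [Function.uncurry_apply_pair]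
      rw [norm_mul, norm_exp_neg_two_pi_I, one_mul, Complex.norm_real, Real.norm_eq_abs,
        abs_of_nonneg (by positivity), mul_assoc]
    simp_rw [this]
    rw [integral_const_mul, integral_exp_neg_mul_pow_four hl, e]
    ring

lemma integral_cexp_mul_quartic_ae (s : ℝ) {τ : ℝ} (hτ : τ ≠ 0) (ξ : ℝ) :
    (fun x : ℝ => ∫ l in Ioi (0 : ℝ),
      Complex.exp (-2 * (Real.pi : ℂ) * Complex.I * (x : ℂ) * (ξ : ℂ)) *
      ((l ^ (s / 4 - 3 / 2) * (Real.exp (-(Real.pi ^ 2 * τ ^ 2 / l)) *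
        Real.exp (-l * x ^ 4)) : ℝ) : ℂ)) =ᵐ[volume]
    fun x : ℝ => Complex.exp (-2 * (Real.pi : ℂ) * Complex.I * (x : ℂ) * (ξ : ℂ)) *
      (((Real.pi * |τ|) ^ ((s - 2) / 2) *
        cliffordK ((s - 2) / 4) (x ^ 4 * (Real.pi ^ 2 * τ ^ 2)) : ℝ) : ℂ) := by
  have h0 : ∀ᵐ x : ℝ, x ≠ 0 := by simp [ae_iff]
  filter_upwards [h0] with x hx
  rw [integral_const_mul, integral_complex_ofReal, integral_rpow_mul_exp_quartic s hx hτ]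

lemma integrable_cexp_mul_cliffordK {s : ℝ} (hs3 : s < 3) {τ : ℝ} (hτ : τ ≠ 0) (ξ : ℝ) :
    Integrable fun x : ℝ => Complex.exp (-2 * (Real.pi : ℂ) * Complex.I * (x : ℂ) * (ξ : ℂ)) *
      (((Real.pi * |τ|) ^ ((s - 2) / 2) *
        cliffordK ((s - 2) / 4) (x ^ 4 * (Real.pi ^ 2 * τ ^ 2)) : ℝ) : ℂ) :=
  (integrable_prod_quartic hs3 hτ ξ).integral_prod_right.congr (integral_cexp_mul_quartic_ae s hτ ξ)

lemma quarticSuperposition_eq {s : ℝ} (hs3 : s < 3) {ξ : Plane} (h1 : ξ 1 ≠ 0) :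
    quarticSuperposition s ξ = (√Real.pi : ℂ) *
      ∫ x : ℝ, Complex.exp (-2 * (Real.pi : ℂ) * Complex.I * (x : ℂ) * ((ξ 0 : ℝ) : ℂ)) *
      (((Real.pi * |ξ 1|) ^ ((s - 2) / 2) *
        cliffordK ((s - 2) / 4) (x ^ 4 * (Real.pi ^ 2 * ξ 1 ^ 2)) : ℝ) : ℂ) := by
  rw [← integral_congr_ae (integral_cexp_mul_quartic_ae s h1 (ξ 0)),
    ← integral_integral_swap (integrable_prod_quartic hs3 h1 (ξ 0)), ← integral_const_mul,
    quarticSuperposition]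
  refine setIntegral_congr_fun measurableSet_Ioi fun l hl => ?_
  have hl : 0 < l := hl
  have e : ((l ^ (s / 4 - 1) : ℝ) : ℂ) * (√(Real.pi / l) : ℂ) =
      (√Real.pi : ℂ) * ((l ^ (s / 4 - 3 / 2) : ℝ) : ℂ) := by
    exact_mod_cast rpow_mul_sqrt_pi_div s hl
  have hq : ∀ x : ℝ, Complex.exp (-2 * (Real.pi : ℂ) * Complex.I * (x : ℂ) * ((ξ 0 : ℝ) : ℂ)) *
      ((l ^ (s / 4 - 3 / 2) * (Real.exp (-(Real.pi ^ 2 * ξ 1 ^ 2 / l)) *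
        Real.exp (-l * x ^ 4)) : ℝ) : ℂ) =
      (((l ^ (s / 4 - 3 / 2) : ℝ) : ℂ) * ((Real.exp (-(Real.pi ^ 2 * ξ 1 ^ 2 / l)) : ℝ) : ℂ)) *
      (Complex.exp (-2 * (Real.pi : ℂ) * Complex.I * (x : ℂ) * ((ξ 0 : ℝ) : ℂ)) *
        ((Real.exp (-l * x ^ 4) : ℝ) : ℂ)) := by
    intro x
    rw [Complex.ofReal_mul, Complex.ofReal_mul]
    ring
  simp_rw [hq]
  rw [integral_const_mul, ← quarticFourier, Complex.ofReal_mul]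
  linear_combination (quarticFourier l (ξ 0) *
    ((Real.exp (-(Real.pi ^ 2 * ξ 1 ^ 2 / l)) : ℝ) : ℂ)) * e

/-- The weight |x|^(1-s/2) exactly cancels the factor (x²)^ν with ν = (s-2)/4 that separates K_ν
from `cliffordK`. -/
lemma besselIntegrand_eq {s : ℝ} (hs1 : 1 < s) (hs3 : s < 3) {ξ : Plane} (h1 : ξ 1 ≠ 0) {x : ℝ}
    (hx : x ≠ 0) :
    besselIntegrand s ξ x = ((1 / 2 * (Real.pi * |ξ 1|) ^ (-((s - 2) / 4)) : ℝ) : ℂ) *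
      (Complex.exp (-2 * (Real.pi : ℂ) * Complex.I * (x : ℂ) * ((ξ 0 : ℝ) : ℂ)) *
      (((Real.pi * |ξ 1|) ^ ((s - 2) / 2) *
        cliffordK ((s - 2) / 4) (x ^ 4 * (Real.pi ^ 2 * ξ 1 ^ 2)) : ℝ) : ℂ)) := by
  have hτ : 0 < |ξ 1| := abs_pos.2 h1
  have hx2 : 0 < x ^ 2 := by positivity
  have hp : 0 < Real.pi * |ξ 1| := by positivity
  rw [besselIntegrand, mul_left_comm, ← Complex.ofReal_mul]
  congr 2
  rw [modBesselK_eq (abs_lt.2 ⟨by linarith, by linarith⟩) (by positivity)]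
  have e1 : (2 * Real.pi * |ξ 1| * x ^ 2) ^ 2 / 4 = x ^ 4 * (Real.pi ^ 2 * ξ 1 ^ 2) := by
    rw [← sq_abs (ξ 1)]; ring
  have e2 : 2 * Real.pi * |ξ 1| * x ^ 2 / 2 = (Real.pi * |ξ 1|) * x ^ 2 := by ring
  have e3 : |x| ^ (1 - s / 2) * (x ^ 2) ^ ((s - 2) / 4) = 1 := by
    have : 1 - s / 2 + 2 * ((s - 2) / 4) = 0 := by ring
    rw [← sq_abs x, ← Real.rpow_two, ← Real.rpow_mul (abs_nonneg x),
      ← Real.rpow_add (abs_pos.2 hx), this, Real.rpow_zero]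
  have e4 : (Real.pi * |ξ 1|) ^ (-((s - 2) / 4)) * (Real.pi * |ξ 1|) ^ ((s - 2) / 2) =
      (Real.pi * |ξ 1|) ^ ((s - 2) / 4) := by
    rw [← Real.rpow_add hp]; ring_nf
  rw [e1, e2, Real.mul_rpow hp.le hx2.le]
  linear_combination (1 / 2 * (Real.pi * |ξ 1|) ^ ((s - 2) / 4) *
    cliffordK ((s - 2) / 4) (x ^ 4 * (Real.pi ^ 2 * ξ 1 ^ 2))) * e3 - (1 / 2 *
    cliffordK ((s - 2) / 4) (x ^ 4 * (Real.pi ^ 2 * ξ 1 ^ 2))) * e4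

lemma integrable_besselIntegrand {s : ℝ} (hs1 : 1 < s) (hs3 : s < 3) {ξ : Plane} (h1 : ξ 1 ≠ 0) :
    Integrable (besselIntegrand s ξ) := by
  have h0 : ∀ᵐ x : ℝ, x ≠ 0 := by simp [ae_iff]
  refine ((integrable_cexp_mul_cliffordK hs3 h1 (ξ 0)).const_mul
    ((1 / 2 * (Real.pi * |ξ 1|) ^ (-((s - 2) / 4)) : ℝ) : ℂ)).congr ?_
  filter_upwards [h0] with x hx
  exact (besselIntegrand_eq hs1 hs3 h1 hx).symm

lemma quarticSuperposition_eq_besselIntegrand {s : ℝ} (hs1 : 1 < s) (hs3 : s < 3) {ξ : Plane}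
    (h1 : ξ 1 ≠ 0) :
    quarticSuperposition s ξ = ((2 * Real.pi ^ (s / 4) * |ξ 1| ^ ((s - 2) / 4) : ℝ) : ℂ) *
      ∫ x : ℝ, besselIntegrand s ξ x := by
  have h0 : ∀ᵐ x : ℝ, x ≠ 0 := by simp [ae_iff]
  have hp : 0 < Real.pi * |ξ 1| := by have := abs_pos.2 h1; positivity
  rw [integral_congr_ae (g := fun x : ℝ => ((1 / 2 * (Real.pi * |ξ 1|) ^ (-((s - 2) / 4)) : ℝ) : ℂ) *
      (Complex.exp (-2 * (Real.pi : ℂ) * Complex.I * (x : ℂ) * ((ξ 0 : ℝ) : ℂ)) *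
      (((Real.pi * |ξ 1|) ^ ((s - 2) / 2) *
        cliffordK ((s - 2) / 4) (x ^ 4 * (Real.pi ^ 2 * ξ 1 ^ 2)) : ℝ) : ℂ)))
    (by filter_upwards [h0] with x hx using besselIntegrand_eq hs1 hs3 h1 hx),
    integral_const_mul, ← mul_assoc, ← Complex.ofReal_mul, quarticSuperposition_eq hs3 h1]
  congr 2
  have e : Real.pi ^ (s / 4) * |ξ 1| ^ ((s - 2) / 4) =
      √Real.pi * (Real.pi * |ξ 1|) ^ ((s - 2) / 4) := by
    rw [Real.mul_rpow Real.pi_pos.le (abs_nonneg _), Real.sqrt_eq_rpow, ← mul_assoc,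
      ← Real.rpow_add Real.pi_pos]
    ring_nf
  have e2 : (Real.pi * |ξ 1|) ^ ((s - 2) / 4) * (Real.pi * |ξ 1|) ^ (-((s - 2) / 4)) = 1 := by
    rw [← Real.rpow_add hp]; simp
  linear_combination (-(Real.pi * |ξ 1|) ^ (-((s - 2) / 4))) * e - √Real.pi * e2

/-! ### Positive representation and bounds -/

/-- The profile `M(r) = ∫₀^∞ v^(s/4-1) (1+v)^(-3/4) exp(-(π/2) r (1+v)^(-1/2)) dv`. -/
noncomputable def poissonProfile (s r : ℝ) : ℝ :=
  ∫ v in Ioi (0 : ℝ), v ^ (s / 4 - 1) * (1 + v) ^ (-(3 / 4) : ℝ) *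
    Real.exp (-(Real.pi / 2 * r * (1 + v) ^ (-(1 / 2) : ℝ)))

lemma measurable_poissonProfile (s : ℝ) : Measurable (poissonProfile s) := by
  refine (StronglyMeasurable.integral_prod_right (f := fun (r v : ℝ) =>
    v ^ (s / 4 - 1) * (1 + v) ^ (-(3 / 4) : ℝ) *
    Real.exp (-(Real.pi / 2 * r * (1 + v) ^ (-(1 / 2) : ℝ)))) ?_).measurable
  refine Measurable.stronglyMeasurable ?_
  unfold Function.uncurry
  fun_prop

lemma integrableOn_Ioc_rpow_sub_one {s : ℝ} (hs0 : 0 < s) :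
    IntegrableOn (fun v : ℝ => v ^ (s / 4 - 1)) (Ioc 0 1) :=
  (intervalIntegrable_iff_integrableOn_Ioc_of_le zero_le_one).1
    (intervalIntegral.intervalIntegrable_rpow' (by linarith))

lemma integrableOn_poissonWeight {s : ℝ} (hs0 : 0 < s) (hs3 : s < 3) :
    IntegrableOn (fun v : ℝ => v ^ (s / 4 - 1) * (1 + v) ^ (-(3 / 4) : ℝ)) (Ioi 0) := by
  have hm : Measurable fun v : ℝ => v ^ (s / 4 - 1) * (1 + v) ^ (-(3 / 4) : ℝ) := by fun_prop
  rw [← Ioc_union_Ioi_eq_Ioi zero_le_one]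
  refine IntegrableOn.union ?_ ?_
  · refine Integrable.mono' (integrableOn_Ioc_rpow_sub_one hs0) hm.aestronglyMeasurable ?_
    filter_upwards [ae_restrict_mem measurableSet_Ioc] with v hv
    have hv0 : 0 < v := hv.1
    rw [Real.norm_eq_abs, abs_of_nonneg (by positivity)]
    exact mul_le_of_le_one_right (by positivity)
      (Real.rpow_le_one_of_one_le_of_nonpos (by linarith) (by norm_num))
  · refine Integrable.mono' (integrableOn_Ioi_rpow_of_lt (a := s / 4 - 1 + -(3 / 4)) (by linarith)
      one_pos) hm.aestronglyMeasurable ?_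
    filter_upwards [ae_restrict_mem measurableSet_Ioi] with v hv
    have hv1 : 1 < v := hv
    have hv0 : 0 < v := by linarith
    rw [Real.norm_eq_abs, abs_of_nonneg (by positivity), Real.rpow_add hv0]
    exact mul_le_mul_of_nonneg_left
      (Real.rpow_le_rpow_of_nonpos hv0 (by linarith) (by norm_num)) (by positivity)

lemma integrableOn_poissonProfile {s : ℝ} (hs0 : 0 < s) (hs3 : s < 3) {r : ℝ} (hr : 0 ≤ r) :
    IntegrableOn (fun v : ℝ => v ^ (s / 4 - 1) * (1 + v) ^ (-(3 / 4) : ℝ) *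
      Real.exp (-(Real.pi / 2 * r * (1 + v) ^ (-(1 / 2) : ℝ)))) (Ioi 0) := by
  refine Integrable.mono' (integrableOn_poissonWeight hs0 hs3) (by fun_prop : Measurable _
    ).aestronglyMeasurable ?_
  filter_upwards [ae_restrict_mem measurableSet_Ioi] with v hv
  have hv : 0 < v := hv
  rw [Real.norm_eq_abs, abs_of_nonneg (by positivity)]
  refine mul_le_of_le_one_right (by positivity) (Real.exp_le_one_iff.2 ?_)
  rw [neg_nonpos]; positivity

lemma poissonProfile_pos {s : ℝ} (hs0 : 0 < s) (hs3 : s < 3) {r : ℝ} (hr : 0 ≤ r) :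
    0 < poissonProfile s r := by
  refine (setIntegral_pos_iff_support_of_nonneg_ae ?_ (integrableOn_poissonProfile hs0 hs3 hr)).2 ?_
  · filter_upwards [ae_restrict_mem measurableSet_Ioi] with v hv
    have hv : 0 < v := hv
    simp only [Pi.zero_apply]; positivity
  · refine lt_of_lt_of_le ?_ (measure_mono (s := Ioi (0 : ℝ)) fun v hv => ⟨?_, hv⟩)
    · simp
    · have hv : 0 < v := hv
      simp only [Function.mem_support]; positivity

lemma poissonProfile_le {s : ℝ} (hs0 : 0 < s) (hs3 : s < 3) {r : ℝ} (hr : 0 ≤ r) :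
    poissonProfile s r ≤ poissonProfile s 0 := by
  refine setIntegral_mono_on (integrableOn_poissonProfile hs0 hs3 hr)
    (integrableOn_poissonProfile hs0 hs3 le_rfl) measurableSet_Ioi fun v hv => ?_
  have hv : 0 < v := hv
  gcongr

/-- For v ≤ 1 the exponential is at most exp(-r), which is below r^(-(3-s)/2) because 0 < (3-s)/2 ≤
1. For v > 1 the integrand is below v^(s/4-7/4) exp(-r v^(-1/2)), whose integral over the whole
half-line is a Gamma value times r^(-(3-s)/2). -/
lemma exists_poissonProfile_le_rpow {s : ℝ} (hs1 : 1 < s) (hs3 : s < 3) :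
    ∃ C : ℝ, ∀ r : ℝ, 0 < r → poissonProfile s r ≤ C * r ^ (-((3 - s) / 2)) := by
  have hp : 0 < (3 - s) / 2 := by linarith
  refine ⟨(∫ v in Ioc (0 : ℝ) 1, v ^ (s / 4 - 1)) + (1 / 2)⁻¹ * Real.Gamma ((3 - s) / 2),
    fun r hr => ?_⟩
  obtain ⟨hN, hNv⟩ := integrableOn_and_integral_rpow_mul_exp_neg_mul_rpow_neg hp hr
    (q := 1 / 2) (by norm_num)
  have hA : IntegrableOn (fun v : ℝ => v ^ (s / 4 - 1) * r ^ (-((3 - s) / 2))) (Ioc 0 1) :=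
    (integrableOn_Ioc_rpow_sub_one (by linarith : 0 < s)).mul_const _
  have hA' : Integrable ((Ioc (0 : ℝ) 1).indicator fun v =>
      v ^ (s / 4 - 1) * r ^ (-((3 - s) / 2))) := hA.integrable_indicator measurableSet_Ioc
  have hAv : ∫ v in Ioi (0 : ℝ), (Ioc (0 : ℝ) 1).indicator (fun v =>
      v ^ (s / 4 - 1) * r ^ (-((3 - s) / 2))) v =
      (∫ v in Ioc (0 : ℝ) 1, v ^ (s / 4 - 1)) * r ^ (-((3 - s) / 2)) := by
    rw [setIntegral_indicator measurableSet_Ioc, inter_eq_self_of_subset_right Ioc_subset_Ioi_self,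
      integral_mul_const]
  rw [add_mul, ← hAv, ← hNv, ← integral_add hA'.integrableOn hN]
  refine setIntegral_mono_on (integrableOn_poissonProfile (by linarith) hs3 hr.le)
    (hA'.integrableOn.add hN) measurableSet_Ioi fun v hv => ?_
  have hv0 : 0 < v := hv
  -- With `hsqrt2` this yields (π/2) 2^(-1/2) ≥ (3/2)(2/3) = 1, so the constant in the exponent may
  -- be replaced by 1 in both ranges of v.
  have hpi : 3 / 2 ≤ Real.pi / 2 := by linarith [Real.pi_gt_three]
  have hsqrt2 : 2 / 3 ≤ (2 : ℝ) ^ (-(1 / 2) : ℝ) := by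
    rw [Real.rpow_neg (by norm_num), ← Real.sqrt_eq_rpow]
    rw [show (2 / 3 : ℝ) = (3 / 2)⁻¹ by norm_num]
    refine inv_anti₀ (by positivity) (Real.sqrt_le_iff.2 ⟨by norm_num, by norm_num⟩)
  rcases le_or_gt v 1 with h | h
  · have hm : v ∈ Ioc (0 : ℝ) 1 := ⟨hv0, h⟩
    rw [indicator_of_mem hm]
    refine le_add_of_le_of_nonneg ?_ (by positivity)
    have h1 : (1 + v) ^ (-(3 / 4) : ℝ) ≤ 1 :=
      Real.rpow_le_one_of_one_le_of_nonpos (by linarith) (by norm_num)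
    have h2 : (2 : ℝ) ^ (-(1 / 2) : ℝ) ≤ (1 + v) ^ (-(1 / 2) : ℝ) :=
      Real.rpow_le_rpow_of_nonpos (by positivity) (by linarith) (by norm_num)
    have h3 : Real.exp (-(Real.pi / 2 * r * (1 + v) ^ (-(1 / 2) : ℝ))) ≤ r ^ (-((3 - s) / 2)) := by
      rw [Real.rpow_neg hr.le, Real.exp_neg]
      refine inv_anti₀ (by positivity) ?_
      calc r ^ ((3 - s) / 2) ≤ r + 1 := by
            rcases le_total r 1 with hr1 | hr1
            · linarith [Real.rpow_le_one hr.le hr1 hp.le]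
            · have := Real.rpow_le_rpow_of_exponent_le hr1 (by linarith : (3 - s) / 2 ≤ 1)
              rw [Real.rpow_one] at this; linarith
        _ ≤ Real.exp r := Real.add_one_le_exp r
        _ ≤ _ := by
            apply Real.exp_le_exp.2
            calc r = 3 / 2 * r * (2 / 3) := by ring
              _ ≤ _ := by gcongr; exact hsqrt2.trans h2
    calc _ ≤ v ^ (s / 4 - 1) * 1 * r ^ (-((3 - s) / 2)) := by gcongr
      _ = _ := by ring
  · rw [indicator_of_notMem (fun hm : v ∈ Ioc (0 : ℝ) 1 => absurd hm.2 (not_le.2 h)), zero_add]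
    have e : v ^ (-((3 - s) / 2 * (1 / 2)) - 1) = v ^ (s / 4 - 1) * v ^ (-(3 / 4) : ℝ) := by
      rw [← Real.rpow_add hv0]; ring_nf
    rw [e]
    have h2 : (2 : ℝ) ^ (-(1 / 2) : ℝ) * v ^ (-(1 / 2) : ℝ) ≤ (1 + v) ^ (-(1 / 2) : ℝ) := by
      rw [← Real.mul_rpow (by norm_num) hv0.le]
      exact Real.rpow_le_rpow_of_nonpos (by positivity) (by linarith) (by norm_num)
    have h3 : (1 + v) ^ (-(3 / 4) : ℝ) ≤ v ^ (-(3 / 4) : ℝ) :=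
      Real.rpow_le_rpow_of_nonpos hv0 (by linarith) (by norm_num)
    gcongr
    rw [neg_mul, neg_le_neg_iff]
    calc r * v ^ (-(1 / 2) : ℝ) = 3 / 2 * r * (2 / 3 * v ^ (-(1 / 2) : ℝ)) := by ring
      _ ≤ Real.pi / 2 * r * (2 ^ (-(1 / 2) : ℝ) * v ^ (-(1 / 2) : ℝ)) := by gcongr
      _ ≤ _ := by gcongr

/-- The Fourier transform of the Korányi kernel, in manifestly positive form. -/
noncomputable def koranyiFourier (s : ℝ) (ξ : Plane) : ℝ :=
  (√Real.pi * √Real.pi * Real.pi ^ ((s - 2) / 2) * 2 ^ (-(1 / 2) : ℝ) / Real.Gamma (s / 4) ^ 2) *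
    (|ξ 1| ^ (-((3 - s) / 2)) * poissonProfile s (ξ 0 ^ 2 / |ξ 1|))

lemma koranyiFourier_pos {s : ℝ} (hs0 : 0 < s) (hs3 : s < 3) {ξ : Plane} (h1 : ξ 1 ≠ 0) :
    0 < koranyiFourier s ξ := by
  have := abs_pos.2 h1
  have := poissonProfile_pos hs0 hs3 (r := ξ 0 ^ 2 / |ξ 1|) (by positivity)
  have := Real.Gamma_pos_of_pos (s := s / 4) (by positivity)
  unfold koranyiFourier
  positivity

lemma exists_koranyiFourier_le {s : ℝ} (hs1 : 1 < s) (hs3 : s < 3) :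
    ∃ C : ℝ, 0 < C ∧ ∀ ξ : Plane, ξ 1 ≠ 0 →
      koranyiFourier s ξ ≤ C * koranyiKernel (3 - s) ξ := by
  obtain ⟨C₁, hC₁⟩ := exists_poissonProfile_le_rpow hs1 hs3
  have hM0 := poissonProfile_pos (s := s) (by linarith) hs3 le_rfl
  have hG := Real.Gamma_pos_of_pos (s := s / 4) (by linarith)
  set B := max (poissonProfile s 0) C₁
  have hB : 0 < B := lt_of_lt_of_le hM0 (le_max_left _ _)
  set c := √Real.pi * √Real.pi * Real.pi ^ ((s - 2) / 2) * 2 ^ (-(1 / 2) : ℝ) /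
    Real.Gamma (s / 4) ^ 2 with hc_def
  have hc : 0 < c := by positivity
  refine ⟨c * (B * 2 ^ ((3 - s) / 4)), by positivity, fun ξ h1 => ?_⟩
  have hτ : 0 < |ξ 1| := abs_pos.2 h1
  rw [koranyiFourier, ← hc_def, mul_assoc c]
  refine mul_le_mul_of_nonneg_left ?_ hc.le
  -- Applied with y the larger of |ξ₂| and ξ₁², which is comparable to (ξ₁⁴ + ξ₂²)^(1/2).
  have key : ∀ y : ℝ, 0 < y → ξ 0 ^ 4 + ξ 1 ^ 2 ≤ 2 * y ^ 2 →
      y ^ (-((3 - s) / 2)) ≤ 2 ^ ((3 - s) / 4) * koranyiKernel (3 - s) ξ := by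
    intro y hy h
    have hpos : 0 < ξ 0 ^ 4 + ξ 1 ^ 2 := by positivity
    have e : (2 * y ^ 2) ^ ((3 - s) / 4) = 2 ^ ((3 - s) / 4) * y ^ ((3 - s) / 2) := by
      rw [Real.mul_rpow (by norm_num) (by positivity), ← Real.rpow_two, ← Real.rpow_mul hy.le]
      ring_nf
    rw [koranyiKernel, mul_one_div, Real.rpow_neg hy.le, le_div_iff₀ (by positivity),
      inv_mul_le_iff₀ (by positivity), mul_comm (y ^ _), ← e]
    exact Real.rpow_le_rpow hpos.le h (by linarith)
  rcases le_or_gt (ξ 0 ^ 2) |ξ 1| with h | h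
  · have hk := key |ξ 1| hτ (by
      have : ξ 0 ^ 4 ≤ |ξ 1| ^ 2 := by
        calc ξ 0 ^ 4 = (ξ 0 ^ 2) ^ 2 := by ring
          _ ≤ _ := by gcongr
      rw [sq_abs] at this ⊢; linarith)
    calc |ξ 1| ^ (-((3 - s) / 2)) * poissonProfile s (ξ 0 ^ 2 / |ξ 1|)
        ≤ (2 ^ ((3 - s) / 4) * koranyiKernel (3 - s) ξ) * B :=
          mul_le_mul hk
            ((poissonProfile_le (by linarith) hs3 (by positivity)).trans (le_max_left _ _))
            (poissonProfile_pos (by linarith) hs3 (by positivity)).le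
            (le_trans (by positivity) hk)
      _ = _ := by ring
  · have hx : 0 < ξ 0 ^ 2 := hτ.trans h
    have hk := key (ξ 0 ^ 2) hx (by
      have : |ξ 1| ^ 2 ≤ (ξ 0 ^ 2) ^ 2 := by gcongr
      rw [sq_abs] at this
      nlinarith)
    calc |ξ 1| ^ (-((3 - s) / 2)) * poissonProfile s (ξ 0 ^ 2 / |ξ 1|)
        ≤ |ξ 1| ^ (-((3 - s) / 2)) * (B * (ξ 0 ^ 2 / |ξ 1|) ^ (-((3 - s) / 2))) := by
          gcongr
          refine (hC₁ _ (by positivity)).trans ?_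
          gcongr
          exact le_max_right _ _
      -- The decay exponent of the profile equals that of the prefactor, so |ξ₂| drops out.
      _ = B * (ξ 0 ^ 2) ^ (-((3 - s) / 2)) := by
          rw [mul_left_comm, ← Real.mul_rpow hτ.le (by positivity), mul_div_cancel₀ _ hτ.ne']
      _ ≤ B * (2 ^ ((3 - s) / 4) * koranyiKernel (3 - s) ξ) := by gcongr
      _ = _ := by ring

lemma coordPowerBounded_koranyiFourier {s : ℝ} (hs1 : 1 < s) (hs3 : s < 3) :
    CoordPowerBounded (koranyiFourier s) := by
  have hm : Measurable (koranyiFourier s) := by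
    have := measurable_poissonProfile s
    unfold koranyiFourier
    fun_prop
  obtain ⟨C, hC, h⟩ := exists_koranyiFourier_le hs1 hs3
  obtain ⟨-, D, a, b, ha0, ha1, hb0, hb1, hD⟩ :=
    coordPowerBounded_koranyiKernel (s := 3 - s) (by linarith) (by linarith)
  refine ⟨hm, C * D, a, b, ha0, ha1, hb0, hb1, fun p h0 h1 => ?_⟩
  rw [abs_of_pos (koranyiFourier_pos (by linarith) hs3 h1), mul_assoc]
  exact (h p h1).trans (mul_le_mul_of_nonneg_left ((le_abs_self _).trans (hD p h0 h1)) hC.le)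

/-- Substituting the Poisson-type representation at ν = (s-2)/4 turns the x-integral into a positive
mixture over v of transforms of Gaussians. The representation contributes one 1/Γ(s/4); the other in
`koranyiFourier` undoes the Gamma integral for f_s. -/
lemma quarticSuperposition_eq_koranyiFourier {s : ℝ} (hs1 : 1 < s) (hs3 : s < 3) {ξ : Plane}
    (h1 : ξ 1 ≠ 0) :
    quarticSuperposition s ξ = (Real.Gamma (s / 4) : ℂ) * (koranyiFourier s ξ : ℂ) := by
  have hτ : 0 < |ξ 1| := abs_pos.2 h1
  have hG := Real.Gamma_pos_of_pos (s := s / 4) (by linarith)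
  have hk : ∀ v ∈ Ioi (0 : ℝ), 0 < 2 * Real.pi * |ξ 1| * √(1 + v) := fun v hv => by
    have hv : 0 < v := hv
    positivity
  have hgauss : ∀ v ∈ Ioi (0 : ℝ), √(Real.pi / (2 * Real.pi * |ξ 1| * √(1 + v))) =
      (2 : ℝ) ^ (-(1 / 2) : ℝ) * |ξ 1| ^ (-(1 / 2) : ℝ) * (1 + v) ^ (-(1 / 4) : ℝ) := by
    intro v hv
    have hv : 0 < v := hv
    have e : Real.pi / (2 * Real.pi * |ξ 1| * √(1 + v)) =
        (2 * |ξ 1| * (1 + v) ^ (1 / 2 : ℝ))⁻¹ := by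
      rw [← Real.sqrt_eq_rpow]; field_simp
    rw [e, Real.sqrt_inv, Real.sqrt_eq_rpow, ← Real.rpow_neg (by positivity),
      Real.mul_rpow (by positivity) (by positivity), Real.mul_rpow (by norm_num) hτ.le,
      ← Real.rpow_mul (by positivity)]
    norm_num
  let F : ℝ → ℝ → ℂ := fun v x =>
    Complex.exp (-2 * (Real.pi : ℂ) * Complex.I * (x : ℂ) * ((ξ 0 : ℝ) : ℂ)) *
    ((v ^ (s / 4 - 1) * ((1 + v) ^ (-(1 / 2) : ℝ) *
      Real.exp (-(2 * Real.pi * |ξ 1| * √(1 + v)) * x ^ 2)) : ℝ) : ℂ)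
  have hFm : Measurable (Function.uncurry F) := by
    unfold Function.uncurry; fun_prop
  have hFn : ∀ v ∈ Ioi (0 : ℝ), ∀ x, ‖F v x‖ = v ^ (s / 4 - 1) * (1 + v) ^ (-(1 / 2) : ℝ) *
      Real.exp (-(2 * Real.pi * |ξ 1| * √(1 + v)) * x ^ 2) := by
    intro v hv x
    have hv : 0 < v := hv
    simp only [F]
    rw [norm_mul, norm_exp_neg_two_pi_I, one_mul, Complex.norm_real, Real.norm_eq_abs,
      abs_of_nonneg (by positivity), ← mul_assoc (v ^ (s / 4 - 1))]
  have hpow : ∀ v ∈ Ioi (0 : ℝ), (1 + v) ^ (-(1 / 2) : ℝ) * (1 + v) ^ (-(1 / 4) : ℝ) =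
      (1 + v) ^ (-(3 / 4) : ℝ) := by
    intro v hv
    have hv : 0 < v := hv
    rw [← Real.rpow_add (by positivity)]; norm_num
  have hFint : Integrable (Function.uncurry F) ((volume.restrict (Ioi 0)).prod volume) := by
    rw [integrable_prod_iff hFm.aestronglyMeasurable]
    constructor
    · filter_upwards [ae_restrict_mem measurableSet_Ioi] with v hv
      refine ((integrable_exp_neg_mul_sq (hk v hv)).const_mul
        (v ^ (s / 4 - 1) * (1 + v) ^ (-(1 / 2) : ℝ))).mono'
        (hFm.comp measurable_prodMk_left).aestronglyMeasurable (ae_of_all _ fun x => ?_)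
      exact (hFn v hv x).le
    -- The Gaussian mass in x is a multiple of (1+v)^(-1/4), which changes the weight (1+v)^(-1/2)
    -- into (1+v)^(-3/4).
    · refine ((integrableOn_poissonWeight (by linarith : 0 < s) hs3).const_mul
        ((2 : ℝ) ^ (-(1 / 2) : ℝ) * |ξ 1| ^ (-(1 / 2) : ℝ))).congr ?_
      filter_upwards [ae_restrict_mem measurableSet_Ioi] with v hv
      simp only [Function.uncurry_apply_pair]
      simp_rw [hFn v hv]
      rw [integral_const_mul, integral_gaussian, hgauss v hv, ← hpow v hv]
      ring
  have hinner : ∀ v ∈ Ioi (0 : ℝ), ∫ x, F v x =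
      (((2 : ℝ) ^ (-(1 / 2) : ℝ) * |ξ 1| ^ (-(1 / 2) : ℝ) *
        (v ^ (s / 4 - 1) * (1 + v) ^ (-(3 / 4) : ℝ) *
        Real.exp (-(Real.pi / 2 * (ξ 0 ^ 2 / |ξ 1|) * (1 + v) ^ (-(1 / 2) : ℝ)))) : ℝ) : ℂ) := by
    intro v hv
    have hv0 : 0 < v := hv
    have : ∀ x, F v x = ((v ^ (s / 4 - 1) * (1 + v) ^ (-(1 / 2) : ℝ) : ℝ) : ℂ) *
        (Complex.exp (-2 * (Real.pi : ℂ) * Complex.I * (x : ℂ) * ((ξ 0 : ℝ) : ℂ)) *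
        ((Real.exp (-(2 * Real.pi * |ξ 1| * √(1 + v)) * x ^ 2) : ℝ) : ℂ)) := by
      intro x
      simp only [F]
      rw [Complex.ofReal_mul, Complex.ofReal_mul, Complex.ofReal_mul]
      ring
    simp_rw [this]
    rw [integral_const_mul, integral_cexp_mul_gaussian (hk v hv), ← Complex.ofReal_mul,
      hgauss v hv, ← hpow v hv]
    have e : Real.pi ^ 2 * ξ 0 ^ 2 / (2 * Real.pi * |ξ 1| * √(1 + v)) =
        Real.pi / 2 * (ξ 0 ^ 2 / |ξ 1|) * (1 + v) ^ (-(1 / 2) : ℝ) := by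
      rw [Real.rpow_neg (by positivity), ← Real.sqrt_eq_rpow]
      field_simp
    rw [e]
    congr 1
    ring
  have houter : ∀ x : ℝ, x ≠ 0 →
      Complex.exp (-2 * (Real.pi : ℂ) * Complex.I * (x : ℂ) * ((ξ 0 : ℝ) : ℂ)) *
      (((Real.pi * |ξ 1|) ^ ((s - 2) / 2) *
        cliffordK ((s - 2) / 4) (x ^ 4 * (Real.pi ^ 2 * ξ 1 ^ 2)) : ℝ) : ℂ) =
      (((Real.pi * |ξ 1|) ^ ((s - 2) / 2) * (√Real.pi / Real.Gamma (s / 4)) : ℝ) : ℂ) *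
        ∫ v in Ioi (0 : ℝ), F v x := by
    intro x hx
    have h := integral_rpow_mul_exp_neg_sqrt (ν := (s - 2) / 4) (by linarith)
      (w := x ^ 4 * (Real.pi ^ 2 * ξ 1 ^ 2)) (by positivity)
    have e1 : (s - 2) / 4 + 1 / 2 = s / 4 := by ring
    have e2 : (s - 2) / 4 - 1 / 2 = s / 4 - 1 := by ring
    rw [e1, e2] at h
    have hK : cliffordK ((s - 2) / 4) (x ^ 4 * (Real.pi ^ 2 * ξ 1 ^ 2)) =
        √Real.pi / Real.Gamma (s / 4) * ∫ v in Ioi (0 : ℝ), v ^ (s / 4 - 1) *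
        ((1 + v) ^ (-(1 / 2) : ℝ) *
          Real.exp (-2 * √((1 + v) * (x ^ 4 * (Real.pi ^ 2 * ξ 1 ^ 2))))) := by
      rw [h]
      have : √Real.pi ≠ 0 := by positivity
      field_simp
    have hF : ∫ v in Ioi (0 : ℝ), F v x =
        Complex.exp (-2 * (Real.pi : ℂ) * Complex.I * (x : ℂ) * ((ξ 0 : ℝ) : ℂ)) *
        ((∫ v in Ioi (0 : ℝ), v ^ (s / 4 - 1) * ((1 + v) ^ (-(1 / 2) : ℝ) *
          Real.exp (-2 * √((1 + v) * (x ^ 4 * (Real.pi ^ 2 * ξ 1 ^ 2))))) : ℝ) : ℂ) := by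
      rw [← integral_complex_ofReal, ← integral_const_mul]
      refine setIntegral_congr_fun measurableSet_Ioi fun v hv => ?_
      have hv : 0 < v := hv
      -- The square root reduces x⁴ to x²; this is why the mixture consists of Gaussians.
      have : √((1 + v) * (x ^ 4 * (Real.pi ^ 2 * ξ 1 ^ 2))) =
          √(1 + v) * (x ^ 2 * (Real.pi * |ξ 1|)) := by
        rw [Real.sqrt_mul (by positivity)]
        congr 1
        rw [← sq_abs (ξ 1), Real.sqrt_eq_iff_mul_self_eq (by positivity) (by positivity)]
        ring
      simp only [F]
      rw [this]
      ring_nf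
    rw [hK, hF]
    push_cast
    ring
  have h0 : ∀ᵐ x : ℝ, x ≠ 0 := by simp [ae_iff]
  rw [quarticSuperposition_eq hs3 h1, integral_congr_ae (g := fun x : ℝ =>
      (((Real.pi * |ξ 1|) ^ ((s - 2) / 2) * (√Real.pi / Real.Gamma (s / 4)) : ℝ) : ℂ) *
        ∫ v in Ioi (0 : ℝ), F v x) (by filter_upwards [h0] with x hx using houter x hx),
    integral_const_mul, ← integral_integral_swap hFint,
    setIntegral_congr_fun measurableSet_Ioi hinner, integral_complex_ofReal, integral_const_mul,
    ← poissonProfile, ← Complex.ofReal_mul, ← Complex.ofReal_mul, ← Complex.ofReal_mul]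
  congr 1
  have e : |ξ 1| ^ (-((3 - s) / 2)) = |ξ 1| ^ ((s - 2) / 2) * |ξ 1| ^ (-(1 / 2) : ℝ) := by
    rw [← Real.rpow_add hτ]; ring_nf
  rw [koranyiFourier, e, Real.mul_rpow Real.pi_pos.le hτ.le]
  field_simp

theorem lemma3p2 (s : ℝ) (hs0 : 0 < s) (hs3 : s < 3) :
    ∃ T : 𝓢'(Plane, ℂ), IsGivenBy T (koranyiKernel s) ∧
      (1 < s →
        ∃ g : Plane → ℝ, IsGivenBy (𝓕 T) g ∧
          (∃ C : ℝ, 0 < C ∧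
            ∀ ξ : Plane, ξ 1 ≠ 0 → 0 < g ξ ∧ g ξ ≤ C * koranyiKernel (3 - s) ξ) ∧
          (∀ ξ : Plane, ξ 1 ≠ 0 →
            MeasureTheory.Integrable (besselIntegrand s ξ) MeasureTheory.volume ∧
              (g ξ : ℂ) =
                ((2 * Real.pi ^ (s / 4) * |ξ 1| ^ ((s - 2) / 4) / Real.Gamma (s / 4) : ℝ) : ℂ) *
                  ∫ x : ℝ, besselIntegrand s ξ x)) := by
  obtain ⟨T, hT⟩ := (coordPowerBounded_koranyiKernel hs0 hs3).exists_isGivenBy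
    (koranyiKernel_nonneg s)
  refine ⟨T, hT, fun hs1 => ⟨koranyiFourier s, ?_, ?_, fun ξ h1 => ?_⟩⟩
  · have hF := coordPowerBounded_koranyiFourier hs1 hs3
    refine ⟨hF.locallyIntegrable, fun φ => ⟨hF.integrable_mul φ, ?_⟩⟩
    rw [TemperedDistribution.fourier_apply, (hT.2 (𝓕 φ)).2]
    have hG : (Real.Gamma (s / 4) : ℂ) ≠ 0 := by
      exact_mod_cast (Real.Gamma_pos_of_pos (s := s / 4) (by positivity)).ne'
    -- Both sides are multiplied by Γ(s/4), the normalisation in which the superposition identities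
    -- hold.
    refine mul_left_cancel₀ hG ?_
    rw [integral_fourier_mul_koranyiKernel hs1 hs3, ← integral_const_mul]
    refine integral_congr_ae ?_
    filter_upwards [ae_coord_ne_zero 1] with ξ h1
    rw [quarticSuperposition_eq_koranyiFourier hs1 hs3 h1]
    ring
  · obtain ⟨C, hC, h⟩ := exists_koranyiFourier_le hs1 hs3
    exact ⟨C, hC, fun ξ h1 => ⟨koranyiFourier_pos hs0 hs3 h1, h ξ h1⟩⟩
  · refine ⟨integrable_besselIntegrand hs1 hs3 h1, ?_⟩
    have hG : (Real.Gamma (s / 4) : ℂ) ≠ 0 := by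
      exact_mod_cast (Real.Gamma_pos_of_pos (s := s / 4) (by positivity)).ne'
    refine mul_left_cancel₀ hG ?_
    rw [← quarticSuperposition_eq_koranyiFourier hs1 hs3 h1,
      quarticSuperposition_eq_besselIntegrand hs1 hs3 h1, Complex.ofReal_div]
    field_simp
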